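/- Let $\gamma\colon\mathbb{R}\to\mathbb{R}^2$ be a periodic parametrization, of period $\ell>0$, of a closed simple smooth regular plane curve; that is, $\gamma$ is $C^\infty$, $\gamma'(t)\neq 0$ for all $t$, $\gamma(t+\ell)=\gamma(t)$ for all $t$, and $\gamma$ is injective on $[0,\ell)$. Let $C=\gamma(\mathbb{R})$, and let $\mathrm{T}=\gamma'/|\gamma'|$, $\mathrm{N}$ (the rotation of $\mathrm{T}$ by $\pi/2$ counterclockwise) and $k$ be the unit tangent, the unit normal and the signed curvature of $\gamma$. The osculating circline $\sigma_t$ of $\gamma$ at $t$ is the circle of radius $1/|k(t)|$ centered at $\gamma(t)+\tfrac1{k(t)}\mathrm{N}(t)$ if $k(t)\neq 0$, and the tangent line to $\gamma$ at $t$ if $k(t)=0$. It globally supports $\gamma$ at the point $\gamma(t)\in\sigma_t$ if $C$ lies in one of the two closed regions into which $\sigma_t$ divides the plane; it does so from inside (respectively, from outside) if, moreover, $\sigma_t$ lies in the closed bounded (respectively, closed unbounded) region into which $C$ divides the plane. Then there are four distinct points $p_1,p_2,p_3,p_4$ of $C$ such that $\gamma$ is globally supported at $p_1$ and $p_2$ from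 inside, and at $p_3$ and $p_4$ from outside, by its osculating circline at that point. Moreover, $\gamma$ has at least four vertices: there are four distinct points $\gamma(t)$ of $C$ with $k'(t)=0$. -/

import Mathlib

open scoped ContDiff

/-- The Euclidean plane. -/
abbrev Plane : Type := EuclideanSpace ℝ (Fin 2)

/-- `γ` is an `ℓ`-periodic smooth regular parametrization of a closed simple plane curve;
the curve itself, as a set of points, is `Set.range γ`. -/
structure IsSimpleClosedSmoothRegularCurve (γ : ℝ → Plane) (ℓ : ℝ) : Prop where
  smooth : ContDiff ℝ ∞ γ
  regular : ∀ t, deriv γ t ≠ 0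
  period_pos : 0 < ℓ
  periodic : Function.Periodic γ ℓ
  simple : Set.InjOn γ (Set.Ico 0 ℓ)

namespace PlaneCurve

/-- Counterclockwise rotation of the plane by the angle `π / 2`. -/
noncomputable def rotate (v : Plane) : Plane := !₂[-(v 1), v 0]

/-- The unit tangent vector of a regular curve. -/
noncomputable def tangent (γ : ℝ → Plane) (t : ℝ) : Plane := ‖deriv γ t‖⁻¹ • deriv γ t

/-- The unit normal vector: `tangent γ t, normal γ t` is an oriented orthonormal frame. -/
noncomputable def normal (γ : ℝ → Plane) (t : ℝ) : Plane := rotate (tangent γ t)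

/-- The signed curvature of a regular curve: the component along the normal of the derivative
of the unit tangent with respect to arc length. -/
noncomputable def signedCurvature (γ : ℝ → Plane) (t : ℝ) : ℝ :=
  inner ℝ (deriv (tangent γ) t) (normal γ t) / ‖deriv γ t‖

/-- The regular curve `γ` has a vertex at `t`: its signed curvature is critical at `t`. -/
def IsVertexAt (γ : ℝ → Plane) (t : ℝ) : Prop :=
  HasDerivAt (signedCurvature γ) 0 t

/-- The circline (circle or line) through `p` with unit tangent vector `T` at `p` and constant
signed curvature `k`, as a set of points. -/
noncomputable def circline (p T : Plane) (k : ℝ) : Set Plane :=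
  if k = 0 then Set.range (fun s : ℝ => p + s • T)
  else Metric.sphere (p + k⁻¹ • rotate T) |k|⁻¹

/-- The osculating circline of the regular curve `γ` at `t`. -/
noncomputable def osculatingCircline (γ : ℝ → Plane) (t : ℝ) : Set Plane :=
  circline (γ t) (tangent γ t) (signedCurvature γ t)

/-- `R` is one of the closed regions into which the curve `C` divides the plane: a connected
component of the complement of `C`, together with `C`. -/
def IsClosedRegion (C R : Set Plane) : Prop :=
  ∃ x ∈ Cᶜ, R = connectedComponentIn Cᶜ x ∪ C

/-- The points that lie inside the closed curve `C`. -/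
def inside (C : Set Plane) : Set Plane :=
  {x | x ∈ Cᶜ ∧ Bornology.IsBounded (connectedComponentIn Cᶜ x)}

/-- The points that lie outside the closed curve `C`. -/
def outside (C : Set Plane) : Set Plane :=
  {x | x ∈ Cᶜ ∧ ¬ Bornology.IsBounded (connectedComponentIn Cᶜ x)}

/-- The simple proper curve with point set `σ` globally supports the curve with point set `C`
at the point `p`. -/
def GloballySupportsAt (σ C : Set Plane) (p : Plane) : Prop :=
  p ∈ σ ∧ p ∈ C ∧ ∃ R, IsClosedRegion σ R ∧ C ⊆ R

/-- `σ` globally supports the closed simple curve `C` at `p` from inside. -/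
def GloballySupportsFromInsideAt (σ C : Set Plane) (p : Plane) : Prop :=
  GloballySupportsAt σ C p ∧ σ ⊆ inside C ∪ C

/-- `σ` globally supports the closed simple curve `C` at `p` from outside. -/
def GloballySupportsFromOutsideAt (σ C : Set Plane) (p : Plane) : Prop :=
  GloballySupportsAt σ C p ∧ σ ⊆ outside C ∪ C

end PlaneCurve

/-!
Fix a point of the curve and push a circle (or, past infinite radius, a line or the outside of a
circle) tangent to the curve at this point from the left, growing it until it is about to cross the
curve. The largest such supporting circline either is the osculating circline or touches the curve
at another point. Two of these circlines that share a point of the curve coincide, and their sets of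
points of contact do not interleave along the curve, since otherwise the region to the left of one
of them, joined to the right side of the curve, would violate the Jordan curve theorem. Hence a
minimal arc between two points of contact collapses to a point at which the largest supporting
circline is the osculating one. Two points of contact cut the curve into two arcs, each of which
contains such a point; the reversed curve provides the two points on the other side. As the curve
does not cross its osculating circline at any of these points, the derivative of the curvature
vanishes there.

The left and the right side of the curve are distinguished by the winding number, given by the
Cauchy integral, which jumps by one across the curve.
-/

namespace PlaneCurve

open Set Filter Topology

section CauchyIntegral

open Complex

variable {c : ℝ → ℂ} {a b d m : ℝ} {p w x y : ℂ}

/-- The Cauchy integral `∫ dz / (z - x)` along the path `c` restricted to `[a, b]`. -/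
noncomputable def cauchyIntegral (c : ℝ → ℂ) (a b : ℝ) (x : ℂ) : ℂ :=
  ∫ t in a..b, deriv c t / (c t - x)

theorem intervalIntegrable_deriv_div_sub (hc : ContDiff ℝ 1 c) (hx : x ∉ c '' uIcc a b) :
    IntervalIntegrable (fun t => deriv c t / (c t - x)) MeasureTheory.volume a b :=
  ((hc.continuous_deriv le_rfl).continuousOn.div
    (hc.continuous.sub continuous_const).continuousOn fun t ht =>
      sub_ne_zero.2 fun h => hx ⟨t, ht, h⟩).intervalIntegrable

theorem cauchyIntegral_add (hc : ContDiff ℝ 1 c) (h₁ : x ∉ c '' uIcc a b)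
    (h₂ : x ∉ c '' uIcc b d) :
    cauchyIntegral c a b x + cauchyIntegral c b d x = cauchyIntegral c a d x :=
  intervalIntegral.integral_add_adjacent_intervals
    (intervalIntegrable_deriv_div_sub hc h₁) (intervalIntegrable_deriv_div_sub hc h₂)

theorem cauchyIntegral_eq_log_sub_log (hc : ContDiff ℝ 1 c)
    (h : ∀ t ∈ uIcc a b, (c t - x) / w ∈ slitPlane) :
    cauchyIntegral c a b x = log ((c b - x) / w) - log ((c a - x) / w) := by
  refine intervalIntegral.integral_eq_sub_of_hasDerivAt (f := fun t => log ((c t - x) / w))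
    (fun t ht => ?_) (intervalIntegrable_deriv_div_sub hc ?_)
  · have hw : w ≠ 0 := (div_ne_zero_iff.1 (slitPlane_ne_zero (h t ht))).2
    have hlog := (((hc.differentiable one_ne_zero t).hasDerivAt.sub_const x).div_const w).clog_real
      (h t ht)
    rwa [div_div_div_cancel_right₀ hw] at hlog
  · rintro ⟨t, ht, rfl⟩
    simpa using h t ht

theorem sub_div_sub_mem_slitPlane {z : ℂ} (h : ‖x - y‖ < ‖z - y‖) :
    (z - x) / (z - y) ∈ slitPlane := by
  have hzy : 0 < ‖z - y‖ := (norm_nonneg _).trans_lt h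
  have : (z - x) / (z - y) = 1 + (y - x) / (z - y) := by
    field_simp [norm_pos_iff.1 hzy]
    ring
  rw [this]
  refine mem_slitPlane_of_norm_lt_one ?_
  rwa [norm_div, div_lt_one hzy, norm_sub_rev]

theorem cauchyIntegral_sub_eq_log_sub_log (hc : ContDiff ℝ 1 c)
    (hxy : ∀ t ∈ uIcc a b, ‖x - y‖ < ‖c t - y‖) :
    cauchyIntegral c a b x - cauchyIntegral c a b y =
      log ((c b - x) / (c b - y)) - log ((c a - x) / (c a - y)) := by
  have hx : x ∉ c '' uIcc a b := by
    rintro ⟨t, ht, rfl⟩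
    exact lt_irrefl _ (hxy t ht)
  have hy : y ∉ c '' uIcc a b := by
    rintro ⟨t, ht, rfl⟩
    exact (norm_nonneg _).not_gt (by simpa using hxy t ht)
  have hix := intervalIntegrable_deriv_div_sub hc hx
  have hiy := intervalIntegrable_deriv_div_sub hc hy
  rw [cauchyIntegral, cauchyIntegral, ← intervalIntegral.integral_sub hix hiy]
  refine intervalIntegral.integral_eq_sub_of_hasDerivAt
    (f := fun t => log ((c t - x) / (c t - y))) (fun t ht => ?_) (hix.sub hiy)
  have hct := (hc.differentiable one_ne_zero t).hasDerivAt
  have hyt : c t - y ≠ 0 := sub_ne_zero.2 fun h => hy ⟨t, ht, h⟩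
  have hxt : c t - x ≠ 0 := sub_ne_zero.2 fun h => hx ⟨t, ht, h⟩
  refine (((hct.sub_const x).div (hct.sub_const y) hyt).clog_real
    (sub_div_sub_mem_slitPlane (hxy t ht))).congr_deriv ?_
  rw [Pi.div_apply]
  field_simp

theorem eventually_notMem_image_uIcc (hc : Continuous c) (hx : x ∉ c '' uIcc a b) :
    ∀ᶠ y in 𝓝 x, y ∉ c '' uIcc a b :=
  (isCompact_uIcc.image hc).isClosed.isOpen_compl.mem_nhds hx

theorem eventually_forall_norm_sub_lt (hc : Continuous c) (hx : x ∉ c '' uIcc a b) :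
    ∀ᶠ y in 𝓝 x, ∀ t ∈ uIcc a b, ‖y - x‖ < ‖c t - x‖ := by
  obtain ⟨r, hr, hball⟩ := Metric.eventually_nhds_iff.1 (eventually_notMem_image_uIcc hc hx)
  filter_upwards [Metric.ball_mem_nhds x hr] with y hy t ht
  rw [mem_ball_iff_norm] at hy
  by_contra! hle
  exact hball (by rw [dist_eq_norm]; exact hle.trans_lt hy) ⟨t, ht, rfl⟩

theorem hasDerivAt_log_sub_div_sub {z : ℂ} (h : x ≠ z) :
    HasDerivAt (fun y => log ((z - y) / (z - x))) (-1 / (z - x)) x := by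
  have hne : z - x ≠ 0 := sub_ne_zero.2 h.symm
  have hdiv : HasDerivAt (fun y => (z - y) / (z - x)) (-1 / (z - x)) x :=
    ((hasDerivAt_id x).const_sub z).div_const _
  simpa [hne] using hdiv.clog (by rw [div_self hne]; exact one_mem_slitPlane)

theorem hasDerivAt_cauchyIntegral (hc : ContDiff ℝ 1 c) (hx : x ∉ c '' uIcc a b) :
    HasDerivAt (cauchyIntegral c a b) (1 / (c a - x) - 1 / (c b - x)) x := by
  have hlog : ∀ t ∈ uIcc a b,
      HasDerivAt (fun y => log ((c t - y) / (c t - x))) (-1 / (c t - x)) x :=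
    fun t ht => hasDerivAt_log_sub_div_sub fun h => hx ⟨t, ht, h.symm⟩
  have heq : cauchyIntegral c a b =ᶠ[𝓝 x] fun y => cauchyIntegral c a b x +
      (log ((c b - y) / (c b - x)) - log ((c a - y) / (c a - x))) := by
    filter_upwards [eventually_forall_norm_sub_lt hc.continuous hx] with y hy
    rw [← cauchyIntegral_sub_eq_log_sub_log hc hy, add_sub_cancel]
  refine ((((hlog b right_mem_uIcc).sub (hlog a left_mem_uIcc)).const_add _).congr_of_eventuallyEq
    heq).congr_deriv ?_
  ring

theorem log_sub_log_neg_of_im_pos {z : ℂ} (hz : 0 < z.im) : log z - log (-z) = Real.pi * I := by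
  rw [log, log, norm_neg, arg_neg_eq_arg_sub_pi_of_im_pos hz]
  push_cast
  ring

theorem tendsto_add_mul_nhdsGT_zero (p w : ℂ) :
    Tendsto (fun ε : ℝ => p + ε * w) (𝓝[>] 0) (𝓝 p) :=
  ((by fun_prop : Continuous fun ε : ℝ => p + ε * w).tendsto' 0 p (by simp)).mono_left
    nhdsWithin_le_nhds

theorem tendsto_sub_mul_nhdsGT_zero (p w : ℂ) :
    Tendsto (fun ε : ℝ => p - ε * w) (𝓝[>] 0) (𝓝 p) := by
  simpa [sub_eq_add_neg] using tendsto_add_mul_nhdsGT_zero p (-w)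

/-- The Cauchy integral along `c` restricted to `[a, b]` jumps by `L` at `p` in the direction `w`:
the path avoids the points `p ± ε w` for small `ε > 0`, and the difference of the values of the
integral at these two points tends to `L`. -/
def HasCauchyJump (c : ℝ → ℂ) (a b : ℝ) (p w L : ℂ) : Prop :=
  (∀ᶠ ε : ℝ in 𝓝[>] 0, p + ε * w ∉ c '' uIcc a b ∧ p - ε * w ∉ c '' uIcc a b) ∧
    Tendsto (fun ε : ℝ => cauchyIntegral c a b (p + ε * w) - cauchyIntegral c a b (p - ε * w))
      (𝓝[>] 0) (𝓝 L)

theorem HasCauchyJump.trans (hc : ContDiff ℝ 1 c) {L L' : ℂ} (h : HasCauchyJump c a b p w L)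
    (h' : HasCauchyJump c b d p w L') : HasCauchyJump c a d p w (L + L') := by
  have hsub : c '' uIcc a d ⊆ c '' uIcc a b ∪ c '' uIcc b d := by
    rw [← image_union]
    exact image_mono uIcc_subset_uIcc_union_uIcc
  refine ⟨?_, (h.2.add h'.2).congr' ?_⟩
  · filter_upwards [h.1, h'.1] with ε hε hε'
    exact ⟨fun hmem => (hsub hmem).elim hε.1 hε'.1, fun hmem => (hsub hmem).elim hε.2 hε'.2⟩
  · filter_upwards [h.1, h'.1] with ε hε hε'
    rw [← cauchyIntegral_add hc hε.1 hε'.1, ← cauchyIntegral_add hc hε.2 hε'.2]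
    ring

theorem hasCauchyJump_zero (hc : ContDiff ℝ 1 c) (hp : p ∉ c '' uIcc a b) (w : ℂ) :
    HasCauchyJump c a b p w 0 := by
  have hoff := eventually_notMem_image_uIcc hc.continuous hp
  have hcont := (hasDerivAt_cauchyIntegral hc hp).continuousAt.tendsto
  have hadd := tendsto_add_mul_nhdsGT_zero p w
  have hsub := tendsto_sub_mul_nhdsGT_zero p w
  refine ⟨(hadd.eventually hoff).and (hsub.eventually hoff), ?_⟩
  simpa using! (hcont.comp hadd).sub (hcont.comp hsub)

theorem sub_sub_mul_div_mem_slitPlane (hw : w ≠ 0) {t ε : ℝ} (hε : 0 < ε)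
    (him : t ≠ m → ((c t - c m) / w).im ≠ 0) : (c t - (c m - ε * w)) / w ∈ slitPlane := by
  have heq : (c t - (c m - ε * w)) / w = (c t - c m) / w + ε := by
    field_simp
    ring
  rw [heq]
  by_cases htm : t = m
  · exact Or.inl (by simpa [htm])
  · exact Or.inr (by simpa using him htm)

/-- With respect to a direction `w` that is transverse to the path at all times, the logarithm of
`(z - x) / w` is a primitive of the Cauchy integrand up to the path. -/
theorem tendsto_cauchyIntegral_sub_mul (hc : ContDiff ℝ 1 c) (hw : w ≠ 0) (ha : a ≠ m)
    (hb : b ≠ m) (him : ∀ t ∈ uIcc a b, t ≠ m → ((c t - c m) / w).im ≠ 0) :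
    Tendsto (fun ε : ℝ => cauchyIntegral c a b (c m - ε * w)) (𝓝[>] 0)
      (𝓝 (log ((c b - c m) / w) - log ((c a - c m) / w))) := by
  have hlog : ∀ t ∈ uIcc a b, t ≠ m → Tendsto (fun ε : ℝ => log ((c t - (c m - ε * w)) / w))
      (𝓝[>] 0) (𝓝 (log ((c t - c m) / w))) := fun t ht htm =>
    ((tendsto_const_nhds.sub (tendsto_sub_mul_nhdsGT_zero (c m) w)).div_const w).clog
      (Or.inr (him t ht htm))
  refine ((hlog b right_mem_uIcc hb).sub (hlog a left_mem_uIcc ha)).congr' ?_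
  filter_upwards [self_mem_nhdsWithin] with ε hε
  exact (cauchyIntegral_eq_log_sub_log hc fun t ht =>
    sub_sub_mul_div_mem_slitPlane hw hε (him t ht)).symm

theorem sub_mul_notMem_image (hw : w ≠ 0) {s : Set ℝ}
    (him : ∀ t ∈ s, t ≠ m → ((c t - c m) / w).im ≠ 0) {ε : ℝ} (hε : 0 < ε) :
    c m - ε * w ∉ c '' s := by
  rintro ⟨t, ht, htm⟩
  simpa [htm] using sub_sub_mul_div_mem_slitPlane hw hε (him t ht)

theorem hasCauchyJump_of_im_sign (hc : ContDiff ℝ 1 c) (hw : w ≠ 0) (ham : a < m) (hmb : m < b)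
    (hpos : ∀ t ∈ Ico a m, 0 < ((c t - c m) / w).im)
    (hneg : ∀ t ∈ Ioc m b, ((c t - c m) / w).im < 0) :
    HasCauchyJump c a b (c m) w (2 * Real.pi * I) := by
  have him : ∀ t ∈ uIcc a b, t ≠ m → ((c t - c m) / w).im ≠ 0 := by
    intro t ht htm
    rw [uIcc_of_le (ham.trans hmb).le] at ht
    rcases htm.lt_or_gt with h | h
    · exact (hpos t ⟨ht.1, h⟩).ne'
    · exact (hneg t ⟨h, ht.2⟩).ne
  have him' : ∀ t ∈ uIcc a b, t ≠ m → ((c t - c m) / -w).im ≠ 0 := by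
    simpa only [div_neg, neg_im, neg_ne_zero] using him
  refine ⟨?_, ?_⟩
  · filter_upwards [self_mem_nhdsWithin] with ε hε
    refine ⟨?_, sub_mul_notMem_image hw him hε⟩
    simpa only [mul_neg, sub_neg_eq_add] using sub_mul_notMem_image (neg_ne_zero.2 hw) him' hε
  · have hleft := tendsto_cauchyIntegral_sub_mul hc (neg_ne_zero.2 hw) ham.ne hmb.ne' him'
    have hright := tendsto_cauchyIntegral_sub_mul hc hw ham.ne hmb.ne' him
    simp only [mul_neg, sub_neg_eq_add, div_neg] at hleft
    convert! hleft.sub hright using 2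
    have ha := log_sub_log_neg_of_im_pos (hpos a ⟨le_rfl, ham⟩)
    have hb := log_sub_log_neg_of_im_pos (z := -((c b - c m) / w)) (by
      simpa using hneg b ⟨hmb, le_rfl⟩)
    rw [neg_neg] at hb
    linear_combination -ha - hb

/-- The jump formula of Plemelj: `w` points to the left of the path at `c m`. -/
theorem hasCauchyJump_two_pi_I (hc : ContDiff ℝ 1 c) (hm : m ∈ Ioo a b)
    (hw : (deriv c m / w).im < 0) (hinj : ∀ t ∈ Icc a b, c t = c m → t = m) :
    HasCauchyJump c a b (c m) w (2 * Real.pi * I) := by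
  have hw0 : w ≠ 0 := by
    rintro rfl
    simp at hw
  have hderiv : HasDerivAt (fun t => ((c t - c m) / w).im) (deriv c m / w).im m :=
    imCLM.hasFDerivAt.comp_hasDerivAt m
      (((hc.differentiable one_ne_zero m).hasDerivAt.sub_const (c m)).div_const w)
  have hsign := eventually_nhdsWithin_sign_eq_of_deriv_neg (hderiv.deriv.trans_lt hw) (by simp)
  obtain ⟨l, u, hlu, hsub⟩ := mem_nhds_iff_exists_Ioo_subset.1
    (hsign.and (Ioo_mem_nhds hm.1 hm.2))
  obtain ⟨a', hla, ham⟩ := exists_between hlu.1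
  obtain ⟨b', hmb, hbu⟩ := exists_between hlu.2
  have hnear : ∀ t ∈ Icc a' b', SignType.sign ((c t - c m) / w).im = SignType.sign (m - t) ∧
      t ∈ Ioo a b := fun t ht => hsub ⟨hla.trans_le ht.1, ht.2.trans_lt hbu⟩
  have haa := (hnear a' ⟨le_rfl, (ham.trans hmb).le⟩).2.1
  have hbb := (hnear b' ⟨(ham.trans hmb).le, le_rfl⟩).2.2
  have hmid : HasCauchyJump c a' b' (c m) w (2 * Real.pi * I) := by
    refine hasCauchyJump_of_im_sign hc hw0 ham hmb (fun t ht => ?_) fun t ht => ?_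
    · rw [← sign_eq_one_iff, (hnear t ⟨ht.1, ht.2.le.trans hmb.le⟩).1, sign_pos (sub_pos.2 ht.2)]
    · rw [← sign_eq_neg_one_iff, (hnear t ⟨ham.le.trans ht.1.le, ht.2⟩).1,
        sign_neg (sub_neg.2 ht.1)]
  have hoff : ∀ q r, q ≤ r → a ≤ q → r ≤ b → m ∉ Icc q r → c m ∉ c '' uIcc q r := by
    rintro q r hqr hq hr hm' ⟨t, ht, htm⟩
    rw [uIcc_of_le hqr] at ht
    exact hm' (hinj t ⟨hq.trans ht.1, ht.2.trans hr⟩ htm ▸ ht)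
  have hleft := hasCauchyJump_zero hc
    (hoff a a' haa.le le_rfl (ham.trans hm.2).le fun h => ham.not_ge h.2) w
  have hright := hasCauchyJump_zero hc
    (hoff b' b hbb.le (hm.1.trans hmb).le le_rfl fun h => hmb.not_ge h.1) w
  simpa using (hleft.trans hc hmid).trans hc hright

theorem eq_of_hasDerivAt_zero {f : ℂ → ℂ} {U T : Set ℂ} (hU : IsOpen U)
    (hf : ∀ x ∈ U, HasDerivAt f 0 x) (hT : IsPreconnected T) (hTU : T ⊆ U)
    (hx : x ∈ T) (hy : y ∈ T) : f x = f y := by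
  have hsub := hT.subset_connectedComponentIn hx hTU
  have hf' := fun z hz => hf z (connectedComponentIn_subset U x hz)
  exact (hU.connectedComponentIn (x := x)).is_const_of_deriv_eq_zero
    isPreconnected_connectedComponentIn
    (fun z hz => (hf' z hz).differentiableAt.differentiableWithinAt)
    (fun z hz => (hf' z hz).deriv) (hsub hx) (hsub hy)

end CauchyIntegral

section CirclineFun

variable {E F : Type*} [NormedAddCommGroup E] [InnerProductSpace ℝ E] [NormedAddCommGroup F]
  [InnerProductSpace ℝ F] {κ : ℝ} {n : E}

/-- A quadratic function that vanishes exactly on the sphere (or hyperplane, for `κ = 0`) through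
`p` with normal vector `n` at `p`. For a unit vector `n` its curvature is `κ`, and the function is
positive on the side that `n` points to. -/
noncomputable def circlineFun (κ : ℝ) (n p x : E) : ℝ :=
  2 * inner ℝ n (x - p) - κ * ‖x - p‖ ^ 2

@[simp]
theorem circlineFun_self (κ : ℝ) (n p : E) : circlineFun κ n p p = 0 := by simp [circlineFun]

theorem circlineFun_neg_neg (κ : ℝ) (n p x : E) :
    circlineFun (-κ) (-n) p x = -circlineFun κ n p x := by
  simp only [circlineFun, inner_neg_left]
  ring

theorem circlineFun_eq_add (κ κ' : ℝ) (n p x : E) :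
    circlineFun κ n p x = circlineFun κ' n p x + (κ' - κ) * ‖x - p‖ ^ 2 := by
  simp only [circlineFun]
  ring

theorem circlineFun_map (e : E →ₗᵢ[ℝ] F) (κ : ℝ) (n p x : E) :
    circlineFun κ (e n) (e p) (e x) = circlineFun κ n p x := by
  simp only [circlineFun, ← map_sub, e.inner_map_map, e.norm_map]

theorem continuous_circlineFun (κ : ℝ) (n p : E) : Continuous (circlineFun κ n p) := by
  unfold circlineFun
  fun_prop

theorem hasDerivAt_circlineFun_comp {γ : ℝ → E} {v : E} {s : ℝ} (hγ : HasDerivAt γ v s)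
    (κ : ℝ) (n p : E) : HasDerivAt (fun s => circlineFun κ n p (γ s))
      (2 * inner ℝ (n - κ • (γ s - p)) v) s := by
  have hsub := hγ.sub_const p
  refine ((((hasDerivAt_const s n).inner ℝ hsub).const_mul 2).sub
    (hsub.norm_sq.const_mul κ)).congr_deriv ?_
  simp only [inner_zero_left, inner_sub_left, real_inner_smul_left]
  ring

theorem norm_sub_smul_sq (κ : ℝ) (n p x : E) :
    ‖n - κ • (x - p)‖ ^ 2 = ‖n‖ ^ 2 - κ * circlineFun κ n p x := by
  rw [norm_sub_sq_real, norm_smul, Real.norm_eq_abs, mul_pow, sq_abs, real_inner_smul_right,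
    circlineFun]
  ring

/-- `n - κ • (x - p)` is the normal vector at `x` of the circline through `x` that is concentric
with the zero set of `circlineFun κ n p`. -/
theorem circlineFun_sub_smul (κ : ℝ) (n p x y : E) :
    circlineFun κ (n - κ • (x - p)) x y = circlineFun κ n p y - circlineFun κ n p x := by
  have hyx : y - x = (y - p) - (x - p) := by abel
  simp only [circlineFun, hyx]
  generalize x - p = u, y - p = v
  simp only [inner_sub_left, inner_sub_right, real_inner_smul_left, norm_sub_sq_real,
    real_inner_self_eq_norm_sq, real_inner_comm u v]
  ring

theorem circlineFun_add_smul (κ ε : ℝ) (n p : E) :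
    circlineFun κ n p (p + ε • n) = ε * ‖n‖ ^ 2 * (2 - κ * ε) := by
  simp only [circlineFun, add_sub_cancel_left, real_inner_smul_right, real_inner_self_eq_norm_sq,
    norm_smul, Real.norm_eq_abs, mul_pow, sq_abs]
  ring

theorem eventually_circlineFun_add_smul_pos (hn : n ≠ 0) (κ : ℝ) (p : E) :
    ∀ᶠ ε : ℝ in 𝓝[>] 0, 0 < circlineFun κ n p (p + ε • n) := by
  have hlim : Tendsto (fun ε : ℝ => 2 - κ * ε) (𝓝[>] 0) (𝓝 2) :=
    ((by fun_prop : Continuous fun ε : ℝ => 2 - κ * ε).tendsto' 0 2 (by simp)).mono_left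
      nhdsWithin_le_nhds
  filter_upwards [hlim.eventually_const_lt two_pos, self_mem_nhdsWithin] with ε hε hε0
  rw [circlineFun_add_smul]
  exact mul_pos (mul_pos hε0 (pow_pos (norm_pos_iff.2 hn) 2)) hε

theorem setOf_circlineFun_nonneg_subset_closure (hn : n ≠ 0) (κ : ℝ) (p : E) :
    {x | 0 ≤ circlineFun κ n p x} ⊆ closure {x | 0 < circlineFun κ n p x} := by
  intro x hx
  rcases (show 0 ≤ circlineFun κ n p x from hx).eq_or_lt with h0 | hpos
  · have hm : n - κ • (x - p) ≠ 0 := by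
      have hnorm := norm_sub_smul_sq κ n p x
      rw [← h0, mul_zero, sub_zero, sq_eq_sq₀ (norm_nonneg _) (norm_nonneg _)] at hnorm
      rwa [← norm_ne_zero_iff, hnorm, norm_ne_zero_iff]
    have hlim : Tendsto (fun ε : ℝ => x + ε • (n - κ • (x - p))) (𝓝[>] 0) (𝓝 x) :=
      ((by fun_prop : Continuous fun ε : ℝ => x + ε • (n - κ • (x - p))).tendsto' 0 x
        (by simp)).mono_left nhdsWithin_le_nhds
    refine mem_closure_of_tendsto hlim ?_
    filter_upwards [eventually_circlineFun_add_smul_pos hm κ x] with ε hε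
    rwa [circlineFun_sub_smul, ← h0, sub_zero] at hε
  · exact subset_closure hpos

theorem isPreconnected_compl_closedBall (hE : 1 < Module.rank ℝ E) (z : E) (r : ℝ) :
    IsPreconnected (Metric.closedBall z r)ᶜ := by
  rcases lt_or_ge r 0 with hr | hr
  · simpa [Metric.closedBall_eq_empty.2 hr] using isPreconnected_univ
  have himage : (fun q : ℝ × E => z + q.1 • q.2) '' (Ioi r ×ˢ Metric.sphere 0 1) =
      (Metric.closedBall z r)ᶜ := by
    ext x
    simp only [mem_compl_iff, mem_closedBall_iff_norm, not_le]
    constructor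
    · rintro ⟨⟨ρ, v⟩, ⟨hρ, hv⟩, rfl⟩
      rw [mem_sphere_zero_iff_norm] at hv
      simpa [norm_smul, hv, abs_of_pos (hr.trans_lt hρ)] using hρ
    · intro hx
      have hx0 : ‖x - z‖ ≠ 0 := (hr.trans_lt hx).ne'
      exact ⟨(‖x - z‖, ‖x - z‖⁻¹ • (x - z)), ⟨hx, by simp [norm_smul, hx0]⟩, by simp [hx0]⟩
  rw [← himage]
  exact (isPreconnected_Ioi.prod (isPreconnected_sphere hE 0 1)).image _ (by fun_prop)

theorem circlineFun_eq_mul (hκ : κ ≠ 0) (n p x : E) :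
    circlineFun κ n p x = κ * ((|κ|⁻¹ * ‖n‖) ^ 2 - ‖x - (p + κ⁻¹ • n)‖ ^ 2) := by
  have hsmul : n - κ • (x - p) = (-κ) • (x - (p + κ⁻¹ • n)) := by
    rw [neg_smul, ← sub_sub, smul_sub _ _ (κ⁻¹ • n), smul_inv_smul₀ hκ, neg_sub]
  have hnorm := norm_sub_smul_sq κ n p x
  rw [hsmul, norm_smul, norm_neg, Real.norm_eq_abs, mul_pow, sq_abs] at hnorm
  generalize ‖x - (p + κ⁻¹ • n)‖ = r at hnorm ⊢
  rw [mul_pow, inv_pow, sq_abs]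
  field_simp
  linear_combination hnorm

theorem setOf_circlineFun_eq_zero (hκ : κ ≠ 0) (n p : E) :
    {x | circlineFun κ n p x = 0} = Metric.sphere (p + κ⁻¹ • n) (|κ|⁻¹ * ‖n‖) := by
  ext x
  rw [mem_ofPred_eq, mem_sphere_iff_norm, circlineFun_eq_mul hκ, mul_eq_zero_iff_left hκ,
    sub_eq_zero, sq_eq_sq₀ (by positivity) (norm_nonneg _), eq_comm]

theorem isPreconnected_setOf_circlineFun_pos (hE : 1 < Module.rank ℝ E) (κ : ℝ) (n p : E) :
    IsPreconnected {x | 0 < circlineFun κ n p x} := by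
  rcases lt_trichotomy κ 0 with hκ | rfl | hκ
  · convert! isPreconnected_compl_closedBall hE (p + κ⁻¹ • n) (|κ|⁻¹ * ‖n‖) using 1
    ext x
    rw [mem_ofPred_eq, mem_compl_iff, mem_closedBall_iff_norm, not_le, circlineFun_eq_mul hκ.ne,
      ← neg_mul_neg, mul_pos_iff_of_pos_left (neg_pos.2 hκ), neg_sub, sub_pos,
      sq_lt_sq₀ (by positivity) (norm_nonneg _)]
  · have hhalf : {x | 0 < circlineFun 0 n p x} = (innerSL ℝ n) ⁻¹' Ioi (inner ℝ n p) := by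
      ext x
      simp [circlineFun, inner_sub_right]
    rw [hhalf]
    exact ((convex_Ioi _).is_linear_preimage (innerSL ℝ n).toLinearMap.isLinear).isPreconnected
  · convert! (convex_ball (p + κ⁻¹ • n) (|κ|⁻¹ * ‖n‖)).isPreconnected using 1
    ext x
    rw [mem_ofPred_eq, mem_ball_iff_norm, circlineFun_eq_mul hκ.ne', mul_pos_iff_of_pos_left hκ,
      sub_pos, sq_lt_sq₀ (norm_nonneg _) (by positivity)]

end CirclineFun

section Rotate

variable {T : Plane}

theorem one_lt_rank_plane : 1 < Module.rank ℝ Plane := by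
  simp [← Module.finrank_eq_rank]

theorem plane_inner_eq (v w : Plane) : inner ℝ v w = v 0 * w 0 + v 1 * w 1 := by
  simp [PiLp.inner_apply, mul_comm]

theorem plane_norm_sq_eq (v : Plane) : ‖v‖ ^ 2 = v 0 ^ 2 + v 1 ^ 2 := by
  simp [EuclideanSpace.norm_sq_eq]

/-- The counterclockwise rotation by `π / 2`, as a linear isometry. -/
noncomputable def rotateLinearIsometry : Plane →ₗᵢ[ℝ] Plane where
  toFun := rotate
  map_add' v w := by
    ext i
    fin_cases i <;> simp [rotate, add_comm]
  map_smul' a v := by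
    ext i
    fin_cases i <;> simp [rotate]
  norm_map' v := by
    refine (sq_eq_sq₀ (norm_nonneg _) (norm_nonneg _)).1 ?_
    simp [plane_norm_sq_eq, rotate, add_comm]

theorem rotateLinearIsometry_apply (v : Plane) : rotateLinearIsometry v = rotate v := rfl

theorem norm_rotate (v : Plane) : ‖rotate v‖ = ‖v‖ := rotateLinearIsometry.norm_map v

theorem rotate_smul (a : ℝ) (v : Plane) : rotate (a • v) = a • rotate v :=
  rotateLinearIsometry.map_smul a v

theorem rotate_neg (v : Plane) : rotate (-v) = -rotate v := rotateLinearIsometry.map_neg v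

theorem rotate_rotate (v : Plane) : rotate (rotate v) = -v := by
  ext i
  fin_cases i <;> simp [rotate]

theorem inner_rotate_self (v : Plane) : inner ℝ (rotate v) v = 0 := by
  simp only [plane_inner_eq, rotate, Matrix.cons_val_zero, Matrix.cons_val_one]
  ring

theorem eq_inner_smul_add_inner_smul_rotate (hT : ‖T‖ = 1) (v : Plane) :
    v = inner ℝ T v • T + inner ℝ (rotate T) v • rotate T := by
  have hsq : T 0 ^ 2 + T 1 ^ 2 = 1 := by rw [← plane_norm_sq_eq, hT, one_pow]
  simp only [plane_inner_eq]
  ext i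
  fin_cases i <;> simp [rotate] <;> linear_combination (-v _) * hsq

theorem eq_rotate_or_eq_neg_rotate (hT : ‖T‖ = 1) {n : Plane} (hn : ‖n‖ = 1)
    (h : inner ℝ T n = 0) : n = rotate T ∨ n = -rotate T := by
  have hn' := eq_inner_smul_add_inner_smul_rotate hT n
  rw [h, zero_smul, zero_add] at hn'
  generalize inner ℝ (rotate T) n = σ at hn'
  rw [hn', norm_smul, norm_rotate, hT, mul_one, Real.norm_eq_abs, abs_eq zero_le_one] at hn
  rcases hn with rfl | rfl
  · exact Or.inl (by rw [hn', one_smul])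
  · exact Or.inr (by rw [hn', neg_one_smul])

theorem circline_eq_setOf_circlineFun_eq_zero (hT : ‖T‖ = 1) (p : Plane) (κ : ℝ) :
    circline p T κ = {x | circlineFun κ (rotate T) p x = 0} := by
  rcases eq_or_ne κ 0 with rfl | hκ
  · rw [circline, if_pos rfl]
    ext x
    simp only [circlineFun, zero_mul, sub_zero, mem_ofPred_eq, mem_range]
    constructor
    · rintro ⟨s, rfl⟩
      simp [real_inner_smul_right, inner_rotate_self]
    · intro hx
      have hframe := eq_inner_smul_add_inner_smul_rotate hT (x - p)
      rw [(mul_eq_zero_iff_left two_ne_zero).1 hx, zero_smul, add_zero] at hframe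
      exact ⟨inner ℝ T (x - p), by rw [← hframe, add_sub_cancel]⟩
  · rw [circline, if_neg hκ, setOf_circlineFun_eq_zero hκ, norm_rotate, hT, mul_one]

end Rotate

section Frame

variable {γ : ℝ → Plane} {t : ℝ}

theorem norm_tangent (ht : deriv γ t ≠ 0) : ‖tangent γ t‖ = 1 := by
  simp [tangent, norm_smul, ht]

theorem norm_normal (ht : deriv γ t ≠ 0) : ‖normal γ t‖ = 1 := by
  rw [normal, norm_rotate, norm_tangent ht]

theorem normal_ne_zero (ht : deriv γ t ≠ 0) : normal γ t ≠ 0 := by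
  simp [← norm_ne_zero_iff, norm_normal ht]

theorem inner_normal_tangent (γ : ℝ → Plane) (t : ℝ) : inner ℝ (normal γ t) (tangent γ t) = 0 :=
  inner_rotate_self _

theorem norm_deriv_smul_tangent (γ : ℝ → Plane) (t : ℝ) :
    ‖deriv γ t‖ • tangent γ t = deriv γ t := by
  rcases eq_or_ne (deriv γ t) 0 with h | h
  · simp [h]
  · simp [tangent, h]

theorem contDiff_deriv (hγ : ContDiff ℝ ∞ γ) : ContDiff ℝ ∞ (deriv γ) :=
  (contDiff_infty_iff_deriv.1 hγ).2

theorem contDiff_tangent (hγ : ContDiff ℝ ∞ γ) (h : ∀ t, deriv γ t ≠ 0) :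
    ContDiff ℝ ∞ (tangent γ) :=
  (((contDiff_deriv hγ).norm ℝ h).inv fun t => norm_ne_zero_iff.2 (h t)).smul (contDiff_deriv hγ)

theorem contDiff_normal (hγ : ContDiff ℝ ∞ γ) (h : ∀ t, deriv γ t ≠ 0) :
    ContDiff ℝ ∞ (normal γ) :=
  rotateLinearIsometry.contDiff.comp (contDiff_tangent hγ h)

theorem contDiff_signedCurvature (hγ : ContDiff ℝ ∞ γ) (h : ∀ t, deriv γ t ≠ 0) :
    ContDiff ℝ ∞ (signedCurvature γ) :=
  (((contDiff_infty_iff_deriv.1 (contDiff_tangent hγ h)).2).inner ℝ (contDiff_normal hγ h)).div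
    ((contDiff_deriv hγ).norm ℝ h) fun t => norm_ne_zero_iff.2 (h t)

theorem hasDerivAt_tangent (hγ : ContDiff ℝ ∞ γ) (h : ∀ t, deriv γ t ≠ 0) (t : ℝ) :
    HasDerivAt (tangent γ) ((‖deriv γ t‖ * signedCurvature γ t) • normal γ t) t := by
  have hT := ((contDiff_tangent hγ h).differentiable (by simp) t).hasDerivAt
  have horth : inner ℝ (tangent γ t) (deriv (tangent γ) t) = 0 := by
    have hsq := hT.norm_sq
    simp only [norm_tangent (h _)] at hsq
    linarith [hsq.unique (hasDerivAt_const t _)]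
  refine hT.congr_deriv ?_
  rw [signedCurvature, mul_div_cancel₀ _ (norm_ne_zero_iff.2 (h t)), real_inner_comm]
  simpa [horth] using! eq_inner_smul_add_inner_smul_rotate (norm_tangent (h t))
    (deriv (tangent γ) t)

theorem hasDerivAt_normal (hγ : ContDiff ℝ ∞ γ) (h : ∀ t, deriv γ t ≠ 0) (t : ℝ) :
    HasDerivAt (normal γ) (-(‖deriv γ t‖ * signedCurvature γ t) • tangent γ t) t := by
  refine (rotateLinearIsometry.toContinuousLinearMap.hasFDerivAt.comp_hasDerivAt t
    (hasDerivAt_tangent hγ h t)).congr_deriv ?_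
  simp only [LinearIsometry.coe_toContinuousLinearMap, rotateLinearIsometry_apply, rotate_smul,
    normal, rotate_rotate, smul_neg, neg_smul]

theorem osculatingCircline_eq (ht : deriv γ t ≠ 0) : osculatingCircline γ t =
    {x | circlineFun (signedCurvature γ t) (normal γ t) (γ t) x = 0} :=
  circline_eq_setOf_circlineFun_eq_zero (norm_tangent ht) _ _

end Frame

section Reverse

/-- The curve `γ` traversed in the opposite direction; the parameter `t` of `γ` corresponds to the
parameter `-t` of the reversed curve. -/
def reverse (γ : ℝ → Plane) (t : ℝ) : Plane := γ (-t)

variable (γ : ℝ → Plane) (t : ℝ)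

theorem range_reverse : range (reverse γ) = range γ :=
  (Equiv.neg ℝ).surjective.range_comp γ

theorem deriv_reverse : deriv (reverse γ) t = -deriv γ (-t) := deriv_comp_neg γ t

theorem tangent_reverse : tangent (reverse γ) t = -tangent γ (-t) := by
  simp [tangent, deriv_reverse]

theorem normal_reverse : normal (reverse γ) t = -normal γ (-t) := by
  rw [normal, tangent_reverse, rotate_neg, normal]

theorem signedCurvature_reverse : signedCurvature (reverse γ) t = -signedCurvature γ (-t) := by
  have htangent : tangent (reverse γ) = fun s => -tangent γ (-s) := funext (tangent_reverse γ)
  have hderiv : deriv (tangent (reverse γ)) t = deriv (tangent γ) (-t) := by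
    rw [htangent, deriv.fun_neg, deriv_comp_neg, neg_neg]
  rw [signedCurvature, hderiv, normal_reverse, deriv_reverse, norm_neg, inner_neg_right, neg_div,
    signedCurvature]

theorem circlineFun_reverse (κ : ℝ) (x : Plane) :
    circlineFun (-κ) (normal (reverse γ) t) (reverse γ t) x =
      -circlineFun κ (normal γ (-t)) (γ (-t)) x := by
  rw [normal_reverse, circlineFun_neg_neg, reverse]

end Reverse

end PlaneCurve

namespace IsSimpleClosedSmoothRegularCurve

open Set PlaneCurve

variable {γ : ℝ → Plane} {ℓ : ℝ} (hγ : IsSimpleClosedSmoothRegularCurve γ ℓ)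
include hγ

theorem eq_of_mem_Ico {s t : ℝ} (hs : s ∈ Ico t (t + ℓ)) (h : γ s = γ t) : s = t := by
  have hmod (x) : γ (toIcoMod hγ.period_pos 0 x) = γ x :=
    hγ.periodic.sub_zsmul_eq (toIcoDiv hγ.period_pos 0 x)
  have hmem (x) : toIcoMod hγ.period_pos 0 x ∈ Ico 0 ℓ := by
    simpa using toIcoMod_mem_Ico hγ.period_pos 0 x
  have hst : toIcoMod hγ.period_pos 0 s = toIcoMod hγ.period_pos 0 t :=
    hγ.simple (hmem s) (hmem t) (by rw [hmod, hmod, h])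
  have hself : toIcoMod hγ.period_pos t s = s := (toIcoMod_eq_self hγ.period_pos).2 hs
  rw [← hself, (toIcoMod_eq_toIcoMod hγ.period_pos).2 ?_, toIcoMod_apply_left]
  exact (toIcoMod_eq_toIcoMod hγ.period_pos).1 hst

theorem reverse : IsSimpleClosedSmoothRegularCurve (reverse γ) ℓ where
  smooth := hγ.smooth.comp contDiff_neg
  regular t := by simpa [deriv_reverse] using hγ.regular (-t)
  period_pos := hγ.period_pos
  periodic t := by
    rw [PlaneCurve.reverse, neg_add', hγ.periodic.sub_eq, PlaneCurve.reverse]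
  simple := by
    rintro s ⟨hs0, hsℓ⟩ t ⟨ht0, htℓ⟩ (h : γ (-s) = γ (-t))
    rcases le_total s t with hst | hst
    · exact neg_injective (hγ.eq_of_mem_Ico ⟨by linarith, by linarith⟩ h)
    · exact neg_injective (hγ.eq_of_mem_Ico ⟨by linarith, by linarith⟩ h.symm).symm

theorem periodic_tangent : Function.Periodic (tangent γ) ℓ := fun t => by
  have hderiv : deriv γ (t + ℓ) = deriv γ t := by
    rw [← deriv_comp_add_const, funext hγ.periodic]
  rw [tangent, tangent, hderiv]

theorem periodic_normal : Function.Periodic (normal γ) ℓ := fun t => by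
  rw [normal, normal, hγ.periodic_tangent]

theorem isCompact_range : IsCompact (range γ) := by
  rw [← hγ.periodic.image_Icc hγ.period_pos 0]
  exact isCompact_Icc.image hγ.smooth.continuous

end IsSimpleClosedSmoothRegularCurve

namespace PlaneCurve

open Set Filter Topology

section MeanVelocity

variable {E : Type*} [NormedAddCommGroup E] [NormedSpace ℝ E] {γ : ℝ → E} {t h : ℝ}

/-- The average velocity of `γ` between the times `t` and `t + h`, extended continuously to
`h = 0`. -/
noncomputable def meanVelocity (γ : ℝ → E) (t h : ℝ) : E :=
  ∫ u in (0 : ℝ)..1, deriv γ (t + u * h)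

/-- The first order Taylor remainder of `γ` at `t` divided by `h ^ 2`, extended continuously to
`h = 0`. -/
noncomputable def meanAcceleration (γ : ℝ → E) (t h : ℝ) : E :=
  ∫ u in (0 : ℝ)..1, (1 - u) • deriv (deriv γ) (t + u * h)

theorem meanVelocity_zero [CompleteSpace E] (γ : ℝ → E) (t : ℝ) :
    meanVelocity γ t 0 = deriv γ t := by
  simp [meanVelocity]

theorem meanAcceleration_zero [CompleteSpace E] (γ : ℝ → E) (t : ℝ) :
    meanAcceleration γ t 0 = (2⁻¹ : ℝ) • deriv (deriv γ) t := by
  simp only [meanAcceleration, mul_zero, add_zero]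
  rw [intervalIntegral.integral_smul_const, intervalIntegral.integral_sub (by simp) (by simp)]
  norm_num

theorem continuous_meanVelocity (hγ : ContDiff ℝ 1 γ) :
    Continuous fun p : ℝ × ℝ => meanVelocity γ p.1 p.2 := by
  have _ := hγ.continuous_deriv le_rfl
  exact intervalIntegral.continuous_parametric_intervalIntegral_of_continuous'
    (by simp only [Function.uncurry_def]; fun_prop) _ _

theorem contDiff_deriv_of_contDiff_two (hγ : ContDiff ℝ 2 γ) : ContDiff ℝ 1 (deriv γ) := by
  rw [← one_add_one_eq_two, contDiff_succ_iff_deriv] at hγ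
  exact hγ.2.2

theorem continuous_meanAcceleration (hγ : ContDiff ℝ 2 γ) :
    Continuous fun p : ℝ × ℝ => meanAcceleration γ p.1 p.2 := by
  have _ := (contDiff_deriv_of_contDiff_two hγ).continuous_deriv le_rfl
  exact intervalIntegral.continuous_parametric_intervalIntegral_of_continuous'
    (by simp only [Function.uncurry_def]; fun_prop) _ _

theorem smul_meanVelocity [CompleteSpace E] (hγ : ContDiff ℝ 1 γ) (t h : ℝ) :
    h • meanVelocity γ t h = γ (t + h) - γ t := by
  have _ := hγ.continuous_deriv le_rfl
  have hderiv (u : ℝ) :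
      HasDerivAt (fun u : ℝ => γ (t + u * h)) (h • deriv γ (t + u * h)) u := by
    have hline : HasDerivAt (fun u : ℝ => t + u * h) h u := by
      simpa using ((hasDerivAt_id u).mul_const h).const_add t
    exact (hγ.differentiable one_ne_zero _).hasDerivAt.scomp u hline
  rw [meanVelocity, ← intervalIntegral.integral_smul,
    intervalIntegral.integral_eq_sub_of_hasDerivAt (f := fun u : ℝ => γ (t + u * h))
      (fun u _ => hderiv u) (Continuous.intervalIntegrable (by fun_prop) _ _)]
  simp

theorem sq_smul_meanAcceleration [CompleteSpace E] (hγ : ContDiff ℝ 2 γ) (t h : ℝ) :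
    h ^ 2 • meanAcceleration γ t h = γ (t + h) - γ t - h • deriv γ t := by
  have hγ' := contDiff_deriv_of_contDiff_two hγ
  have _ := hγ'.continuous_deriv le_rfl
  have hderiv (u : ℝ) :
      HasDerivAt (fun u : ℝ => (1 - u) • h • deriv γ (t + u * h) + γ (t + u * h))
        (h ^ 2 • (1 - u) • deriv (deriv γ) (t + u * h)) u := by
    have hline : HasDerivAt (fun u : ℝ => t + u * h) h u := by
      simpa using ((hasDerivAt_id u).mul_const h).const_add t
    have hfst := (hγ.differentiable two_ne_zero _).hasDerivAt.scomp u hline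
    have hsnd := (hγ'.differentiable one_ne_zero _).hasDerivAt.scomp u hline
    refine ((((hasDerivAt_id u).const_sub 1).smul (hsnd.const_smul h)).add hfst).congr_deriv ?_
    simp only [id_eq, Function.comp_apply, Pi.smul_apply]
    module
  rw [meanAcceleration, ← intervalIntegral.integral_smul,
    intervalIntegral.integral_eq_sub_of_hasDerivAt
      (f := fun u : ℝ => (1 - u) • h • deriv γ (t + u * h) + γ (t + u * h))
      (fun u _ => hderiv u) (Continuous.intervalIntegrable (by fun_prop) _ _)]
  simp
  abel

end MeanVelocity

section ChordCurvature

variable {γ : ℝ → Plane} {t h : ℝ}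

/-- The signed curvature of the circline that is tangent to `γ` at `t` and passes through
`γ (t + h)`, extended continuously to `h = 0`. -/
noncomputable def chordCurvature (γ : ℝ → Plane) (t h : ℝ) : ℝ :=
  2 * inner ℝ (normal γ t) (meanAcceleration γ t h) / ‖meanVelocity γ t h‖ ^ 2

theorem inner_normal_deriv (γ : ℝ → Plane) (t : ℝ) : inner ℝ (normal γ t) (deriv γ t) = 0 := by
  rw [← norm_deriv_smul_tangent, real_inner_smul_right, inner_normal_tangent, mul_zero]

theorem inner_normal_deriv_deriv (hγ : ContDiff ℝ ∞ γ) (hreg : ∀ t, deriv γ t ≠ 0) (t : ℝ) :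
    inner ℝ (normal γ t) (deriv (deriv γ) t) = ‖deriv γ t‖ ^ 2 * signedCurvature γ t := by
  have hspeed := (((contDiff_deriv hγ).norm ℝ hreg).differentiable (by simp) t).hasDerivAt
  have hderiv := (hspeed.smul (hasDerivAt_tangent hγ hreg t)).deriv
  rw [show (fun s => ‖deriv γ s‖) • tangent γ = deriv γ from funext (norm_deriv_smul_tangent γ)]
    at hderiv
  rw [hderiv, inner_add_right, real_inner_smul_right, real_inner_smul_right, real_inner_smul_right,
    inner_normal_tangent, real_inner_self_eq_norm_sq, norm_normal (hreg t)]
  ring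

theorem chordCurvature_zero (hγ : ContDiff ℝ ∞ γ) (hreg : ∀ t, deriv γ t ≠ 0) (t : ℝ) :
    chordCurvature γ t 0 = signedCurvature γ t := by
  have hne := norm_ne_zero_iff.2 (hreg t)
  rw [chordCurvature, meanVelocity_zero, meanAcceleration_zero, real_inner_smul_right,
    inner_normal_deriv_deriv hγ hreg]
  field_simp

theorem circlineFun_chord (hγ : ContDiff ℝ 2 γ) (hv : meanVelocity γ t h ≠ 0) (κ : ℝ) :
    circlineFun κ (normal γ t) (γ t) (γ (t + h)) =
      (chordCurvature γ t h - κ) * ‖γ (t + h) - γ t‖ ^ 2 := by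
  have hnorm : ‖γ (t + h) - γ t‖ ^ 2 = h ^ 2 * ‖meanVelocity γ t h‖ ^ 2 := by
    rw [← smul_meanVelocity (hγ.of_le one_le_two), norm_smul, mul_pow, Real.norm_eq_abs, sq_abs]
  have hinner : inner ℝ (normal γ t) (γ (t + h) - γ t) =
      h ^ 2 * inner ℝ (normal γ t) (meanAcceleration γ t h) := by
    rw [← real_inner_smul_right, sq_smul_meanAcceleration hγ, inner_sub_right (normal γ t) (_ - _),
      real_inner_smul_right, inner_normal_deriv, mul_zero, sub_zero]
  have hv' := norm_ne_zero_iff.2 hv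
  rw [circlineFun, hnorm, hinner, chordCurvature]
  field_simp

theorem continuousAt_chordCurvature (hγ : ContDiff ℝ ∞ γ) (hreg : ∀ t, deriv γ t ≠ 0)
    (hv : meanVelocity γ t h ≠ 0) :
    ContinuousAt (fun p : ℝ × ℝ => chordCurvature γ p.1 p.2) (t, h) := by
  have hvel := continuous_meanVelocity (contDiff_infty.1 hγ 1)
  have hacc := continuous_meanAcceleration (contDiff_infty.1 hγ 2)
  have hnormal := (contDiff_normal hγ hreg).continuous.comp (continuous_fst (Y := ℝ))
  exact ((hnormal.inner hacc).const_mul 2).continuousAt.div (hvel.norm.pow 2).continuousAt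
    (pow_ne_zero 2 (norm_ne_zero_iff.2 hv))

/-- The maximum of the curvatures of the circlines that are tangent to `γ` at `t` and meet `γ`
again, for a closed curve `γ` of period `ℓ`: the curvature of the largest supporting circline that
is tangent to `γ` at `t` from the left. -/
noncomputable def maxCurvature (γ : ℝ → Plane) (ℓ t : ℝ) : ℝ :=
  ⨆ h : Icc (-(ℓ / 2)) (ℓ / 2), chordCurvature γ t h

/-- The closed curve `γ` does not meet the open region that lies to the left of its tangent
circline of curvature `κ` at `t`. -/
def SupportedFromLeft (γ : ℝ → Plane) (κ t : ℝ) : Prop :=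
  ∀ s, circlineFun κ (normal γ t) (γ t) (γ s) ≤ 0

end ChordCurvature

section ThirdDerivative

variable {f g v : ℝ → ℝ} {t : ℝ}

theorem eventually_pos_of_hasDerivAt_mul (hf : ∀ s, HasDerivAt f (v s * g s) s)
    (hv : ∀ s, 0 < v s) (hft : f t = 0) (hg : ∀ᶠ s in 𝓝[>] t, 0 < g s) :
    ∀ᶠ s in 𝓝[>] t, 0 < f s := by
  obtain ⟨u, htu, hpos⟩ := mem_nhdsGT_iff_exists_Ioo_subset.1 hg
  filter_upwards [Ioo_mem_nhdsGT htu] with s hs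
  rw [← hft]
  refine strictMonoOn_of_deriv_pos (convex_Icc t s)
    (fun x _ => (hf x).continuousAt.continuousWithinAt) (fun x hx => ?_)
    (left_mem_Icc.2 hs.1.le) (right_mem_Icc.2 hs.1.le) hs.1
  rw [interior_Icc] at hx
  rw [(hf x).deriv]
  exact mul_pos (hv x) (hpos ⟨hx.1, hx.2.trans hs.2⟩)

variable {w v₁ v₂ : ℝ → ℝ} {d : ℝ}

theorem third_deriv_nonpos (hf : ∀ s, HasDerivAt f (v₁ s * g s) s)
    (hg : ∀ s, HasDerivAt g (v₂ s * w s) s) (hw : HasDerivAt w d t) (hv₁ : ∀ s, 0 < v₁ s)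
    (hv₂ : ∀ s, 0 < v₂ s) (hft : f t = 0) (hgt : g t = 0) (hwt : w t = 0)
    (hle : ∀ s, f s ≤ 0) : d ≤ 0 := by
  by_contra! hd
  have hsign := nhdsWithin_le_nhds (s := Ioi t)
    (eventually_nhdsWithin_sign_eq_of_deriv_pos (hd.trans_eq hw.deriv.symm) hwt)
  have hwpos : ∀ᶠ s in 𝓝[>] t, 0 < w s := by
    filter_upwards [hsign, self_mem_nhdsWithin] with s hs hts
    rwa [sign_pos (sub_pos.2 hts), sign_eq_one_iff] at hs
  obtain ⟨s, hs⟩ := (eventually_pos_of_hasDerivAt_mul hf hv₁ hft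
    (eventually_pos_of_hasDerivAt_mul hg hv₂ hgt hwpos)).exists
  exact (hle s).not_gt hs

theorem third_deriv_eq_zero (hf : ∀ s, HasDerivAt f (v₁ s * g s) s)
    (hg : ∀ s, HasDerivAt g (v₂ s * w s) s) (hw : HasDerivAt w d t) (hv₁ : ∀ s, 0 < v₁ s)
    (hv₂ : ∀ s, 0 < v₂ s) (hft : f t = 0) (hgt : g t = 0) (hwt : w t = 0)
    (hle : ∀ s, f s ≤ 0) : d = 0 := by
  refine le_antisymm (third_deriv_nonpos hf hg hw hv₁ hv₂ hft hgt hwt hle) (neg_nonpos.1 ?_)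
  have hneg (s : ℝ) : HasDerivAt (fun s : ℝ => -s) (-1) s := hasDerivAt_neg s
  refine third_deriv_nonpos (f := fun s => f (-s)) (g := fun s => -g (-s)) (w := fun s => w (-s))
    (v₁ := fun s => v₁ (-s)) (v₂ := fun s => v₂ (-s)) (t := -t) (fun s => ?_) (fun s => ?_) ?_
    (fun s => hv₁ _) (fun s => hv₂ _) (by simpa) (by simpa) (by simpa) fun s => hle _
  · exact ((hf (-s)).comp s (hneg s)).congr_deriv (by ring)
  · exact ((hg (-s)).comp s (hneg s)).neg.congr_deriv (by ring)
  · have hw' : HasDerivAt w d (- -t) := by rwa [neg_neg]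
    exact (hw'.comp (-t) (hneg (-t))).congr_deriv (by ring)

end ThirdDerivative

theorem isVertexAt_of_supportedFromLeft {γ : ℝ → Plane} {t : ℝ} (hγ : ContDiff ℝ ∞ γ)
    (hreg : ∀ t, deriv γ t ≠ 0) (h : SupportedFromLeft γ (signedCurvature γ t) t) :
    IsVertexAt γ t := by
  have hk := ((contDiff_signedCurvature hγ hreg).differentiable (by simp) t).hasDerivAt
  have hγ' (s) : HasDerivAt γ (‖deriv γ s‖ • tangent γ s) s := by
    rw [norm_deriv_smul_tangent]
    exact (hγ.differentiable (by simp) s).hasDerivAt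
  have hpos (s) : 0 < ‖deriv γ s‖ := norm_pos_iff.2 (hreg s)
  have hself (s) : inner ℝ (tangent γ s) (tangent γ s) = (1 : ℝ) := by
    rw [real_inner_self_eq_norm_sq, norm_tangent (hreg s), one_pow]
  have hselfN : inner ℝ (normal γ t) (normal γ t) = (1 : ℝ) := by
    rw [real_inner_self_eq_norm_sq, norm_normal (hreg t), one_pow]
  set k := signedCurvature γ t
  set M : ℝ → Plane := fun s => normal γ t - k • (γ s - γ t) with hM_def
  have hM (s) : HasDerivAt M (-(k * ‖deriv γ s‖) • tangent γ s) s :=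
    ((((hγ' s).sub_const (γ t)).const_smul k).const_sub (normal γ t)).congr_deriv
      (by rw [smul_smul, neg_smul])
  have hMt : M t = normal γ t := by simp [hM_def]
  have hd : deriv (signedCurvature γ) t = 0 := by
    refine third_deriv_eq_zero (t := t) (f := fun s => circlineFun k (normal γ t) (γ t) (γ s))
      (g := fun s => inner ℝ (M s) (tangent γ s))
      (w := fun s => signedCurvature γ s * inner ℝ (M s) (normal γ s) - k)
      (v₁ := fun s => 2 * ‖deriv γ s‖) (v₂ := fun s => ‖deriv γ s‖) (fun s => ?_) (fun s => ?_) ?_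
      (fun s => mul_pos two_pos (hpos s)) hpos (circlineFun_self _ _ _) ?_ ?_ h
    · refine (hasDerivAt_circlineFun_comp (hγ' s) k (normal γ t) (γ t)).congr_deriv ?_
      rw [real_inner_smul_right]
      ring
    · refine ((hM s).inner ℝ (hasDerivAt_tangent hγ hreg s)).congr_deriv ?_
      rw [real_inner_smul_right, real_inner_smul_left, hself]
      ring
    · refine ((hk.mul ((hM t).inner ℝ (hasDerivAt_normal hγ hreg t))).sub_const k).congr_deriv ?_
      rw [hMt, real_inner_smul_right, real_inner_smul_left,
        real_inner_comm (normal γ t) (tangent γ t), inner_normal_tangent, hselfN]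
      ring
    · rw [hMt, inner_normal_tangent]
    · rw [hMt, hselfN, mul_one, sub_self]
  rw [IsVertexAt, ← hd]
  exact hk

theorem isVertexAt_of_isVertexAt_reverse {γ : ℝ → Plane} {t : ℝ} (h : IsVertexAt (reverse γ) t) :
    IsVertexAt γ (-t) := by
  have hcurv : signedCurvature γ = fun s => -signedCurvature (reverse γ) (-s) := by
    funext s
    rw [signedCurvature_reverse, neg_neg, neg_neg]
  rw [IsVertexAt, hcurv]
  rw [IsVertexAt, ← neg_neg t] at h
  exact (h.comp (-t) (hasDerivAt_neg (-t))).neg.congr_deriv (by simp)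

end PlaneCurve

namespace IsSimpleClosedSmoothRegularCurve

open Set Filter Topology PlaneCurve

variable {γ : ℝ → Plane} {ℓ κ t h : ℝ} (hγ : IsSimpleClosedSmoothRegularCurve γ ℓ)
include hγ

theorem contDiff_one : ContDiff ℝ 1 γ := contDiff_infty.1 hγ.smooth 1

theorem contDiff_two : ContDiff ℝ 2 γ := contDiff_infty.1 hγ.smooth 2

theorem apply_add_ne (hh : h ∈ Ioo (-ℓ) ℓ) (h0 : h ≠ 0) : γ (t + h) ≠ γ t := by
  rcases h0.lt_or_gt with hneg | hpos
  · exact fun heq => h0 (by linarith [hγ.eq_of_mem_Ico ⟨by linarith, by linarith [hh.1]⟩ heq.symm])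
  · exact fun heq => h0 (by linarith [hγ.eq_of_mem_Ico ⟨by linarith, by linarith [hh.2]⟩ heq])

theorem meanVelocity_ne_zero (hh : h ∈ Ioo (-ℓ) ℓ) : meanVelocity γ t h ≠ 0 := by
  rcases eq_or_ne h 0 with rfl | h0
  · rw [meanVelocity_zero]
    exact hγ.regular t
  · refine right_ne_zero_of_smul (a := h) ?_
    rw [smul_meanVelocity hγ.contDiff_one]
    exact sub_ne_zero.2 (hγ.apply_add_ne hh h0)

theorem circlineFun_nonpos_iff (hh : h ∈ Ioo (-ℓ) ℓ) (h0 : h ≠ 0) :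
    circlineFun κ (normal γ t) (γ t) (γ (t + h)) ≤ 0 ↔ chordCurvature γ t h ≤ κ := by
  have hpos := pow_pos (norm_pos_iff.2 (sub_ne_zero.2 (hγ.apply_add_ne (t := t) hh h0))) 2
  rw [circlineFun_chord hγ.contDiff_two (hγ.meanVelocity_ne_zero hh),
    ← not_lt, mul_pos_iff_of_pos_right hpos, not_lt, sub_nonpos]

theorem circlineFun_eq_zero_iff (hh : h ∈ Ioo (-ℓ) ℓ) (h0 : h ≠ 0) :
    circlineFun κ (normal γ t) (γ t) (γ (t + h)) = 0 ↔ chordCurvature γ t h = κ := by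
  have hne := pow_ne_zero 2 (norm_ne_zero_iff.2 (sub_ne_zero.2 (hγ.apply_add_ne (t := t) hh h0)))
  rw [circlineFun_chord hγ.contDiff_two (hγ.meanVelocity_ne_zero hh), mul_eq_zero_iff_right hne,
    sub_eq_zero]

theorem Icc_half_period_subset : Icc (-(ℓ / 2)) (ℓ / 2) ⊆ Ioo (-ℓ) ℓ := fun h hh =>
  ⟨by linarith [hh.1, hγ.period_pos], by linarith [hh.2, hγ.period_pos]⟩

theorem zero_mem_Icc_half_period : (0 : ℝ) ∈ Icc (-(ℓ / 2)) (ℓ / 2) :=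
  ⟨by linarith [hγ.period_pos], by linarith [hγ.period_pos]⟩

theorem continuous_chordCurvature : Continuous fun p : ℝ × Icc (-(ℓ / 2)) (ℓ / 2) =>
    chordCurvature γ p.1 p.2 := continuous_iff_continuousAt.2 fun p =>
  (continuousAt_chordCurvature hγ.smooth hγ.regular
    (hγ.meanVelocity_ne_zero (hγ.Icc_half_period_subset p.2.2))).comp
    (f := fun p : ℝ × Icc (-(ℓ / 2)) (ℓ / 2) => (p.1, (p.2 : ℝ))) (by fun_prop)

theorem continuous_maxCurvature : Continuous (maxCurvature γ ℓ) := by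
  simpa only [image_univ] using! isCompact_univ.continuous_sSup hγ.continuous_chordCurvature

theorem chordCurvature_le_maxCurvature (t : ℝ) (hh : h ∈ Icc (-(ℓ / 2)) (ℓ / 2)) :
    chordCurvature γ t h ≤ maxCurvature γ ℓ t :=
  le_ciSup (_root_.isCompact_range (hγ.continuous_chordCurvature.comp (.prodMk_right t))).bddAbove
    (⟨h, hh⟩ : Icc (-(ℓ / 2)) (ℓ / 2))

theorem exists_chordCurvature_eq_maxCurvature (t : ℝ) :
    ∃ h ∈ Icc (-(ℓ / 2)) (ℓ / 2), chordCurvature γ t h = maxCurvature γ ℓ t := by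
  have : Nonempty (Icc (-(ℓ / 2)) (ℓ / 2)) := ⟨⟨0, hγ.zero_mem_Icc_half_period⟩⟩
  obtain ⟨⟨h, hh⟩, heq⟩ :=
    (_root_.isCompact_range (hγ.continuous_chordCurvature.comp (.prodMk_right t))).sSup_mem
      (range_nonempty _)
  exact ⟨h, hh, heq⟩

theorem signedCurvature_le_maxCurvature (t : ℝ) : signedCurvature γ t ≤ maxCurvature γ ℓ t := by
  rw [← chordCurvature_zero hγ.smooth hγ.regular]
  exact hγ.chordCurvature_le_maxCurvature t hγ.zero_mem_Icc_half_period

theorem exists_apply_eq_apply_add (t s : ℝ) :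
    ∃ h ∈ Icc (-(ℓ / 2)) (ℓ / 2), γ s = γ (t + h) := by
  obtain ⟨y, hy, heq⟩ := hγ.periodic.exists_mem_Ico hγ.period_pos s (t - ℓ / 2)
  exact ⟨y - t, ⟨by linarith [hy.1], by linarith [hy.2]⟩, by rw [heq, add_sub_cancel]⟩

theorem supportedFromLeft_maxCurvature (t : ℝ) :
    SupportedFromLeft γ (maxCurvature γ ℓ t) t := by
  intro s
  obtain ⟨h, hh, heq⟩ := hγ.exists_apply_eq_apply_add t s
  rw [heq]
  rcases eq_or_ne h 0 with rfl | h0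
  · simp
  · rw [hγ.circlineFun_nonpos_iff (hγ.Icc_half_period_subset hh) h0]
    exact hγ.chordCurvature_le_maxCurvature t hh

theorem chordCurvature_le (hsupp : SupportedFromLeft γ κ t) (hh : h ∈ Ioo (-ℓ) ℓ) :
    chordCurvature γ t h ≤ κ := by
  rcases eq_or_ne h 0 with rfl | h0
  · have hcont := (continuousAt_chordCurvature hγ.smooth hγ.regular
      (hγ.meanVelocity_ne_zero (t := t) hh)).comp (f := fun h => (t, h)) (by fun_prop)
    refine le_of_tendsto (hcont.tendsto.mono_left (nhdsWithin_le_nhds (s := Ioi 0))) ?_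
    filter_upwards [Ioo_mem_nhdsGT hγ.period_pos] with x hx
    exact (hγ.circlineFun_nonpos_iff ⟨by linarith [hx.1, hγ.period_pos], hx.2⟩ hx.1.ne').1 (hsupp _)
  · exact (hγ.circlineFun_nonpos_iff hh h0).1 (hsupp _)

theorem supportedFromLeft_iff : SupportedFromLeft γ κ t ↔ maxCurvature γ ℓ t ≤ κ := by
  refine ⟨fun hsupp => ?_, fun hle s => ?_⟩
  · obtain ⟨h, hh, heq⟩ := hγ.exists_chordCurvature_eq_maxCurvature t
    exact heq ▸ hγ.chordCurvature_le hsupp (hγ.Icc_half_period_subset hh)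
  · rw [circlineFun_eq_add κ (maxCurvature γ ℓ t)]
    exact add_nonpos (hγ.supportedFromLeft_maxCurvature t s)
      (mul_nonpos_of_nonpos_of_nonneg (sub_nonpos.2 hle) (sq_nonneg _))

theorem periodic_maxCurvature : Function.Periodic (maxCurvature γ ℓ) ℓ := fun t =>
  eq_of_forall_ge_iff fun κ => by
    rw [← hγ.supportedFromLeft_iff, ← hγ.supportedFromLeft_iff, SupportedFromLeft,
      SupportedFromLeft, hγ.periodic, hγ.periodic_normal]

theorem exists_forall_supportedFromLeft : ∃ κ, ∀ t, SupportedFromLeft γ κ t := by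
  have hcomp := hγ.periodic_maxCurvature.compact_of_continuous hγ.period_pos.ne'
    hγ.continuous_maxCurvature
  obtain ⟨κ, hκ⟩ := hcomp.bddAbove
  exact ⟨κ, fun t => hγ.supportedFromLeft_iff.2 (hκ ⟨t, rfl⟩)⟩

end IsSimpleClosedSmoothRegularCurve

namespace PlaneCurve

open Set Filter Topology

/-- The identification of the plane with `ℂ`, which turns `rotate` into multiplication by `I`. -/
noncomputable def toComplex : Plane ≃ₗᵢ[ℝ] ℂ := Complex.orthonormalBasisOneI.repr.symm

theorem toComplex_rotate (v : Plane) : toComplex (rotate v) = Complex.I * toComplex v := by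
  have h (v : Plane) : toComplex v = v 0 + v 1 * Complex.I := by
    simp [toComplex, ← OrthonormalBasis.sum_repr_symm, Fin.sum_univ_two]
  rw [h, h]
  simp only [rotate, PiLp.toLp_apply, Matrix.cons_val_zero, Matrix.cons_val_one]
  push_cast
  linear_combination (-(v 1 : ℂ)) * Complex.I_mul_I

/-- The points that can be joined in the complement of the curve to points near `γ 0` on the left
of the curve. -/
def leftSide (γ : ℝ → Plane) : Set Plane :=
  {x ∈ (range γ)ᶜ |
    ∀ᶠ ε : ℝ in 𝓝[>] 0, γ 0 + ε • normal γ 0 ∈ connectedComponentIn (range γ)ᶜ x}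

/-- The points that can be joined in the complement of the curve to points near `γ 0` on the right
of the curve. -/
def rightSide (γ : ℝ → Plane) : Set Plane := leftSide (reverse γ)

variable {γ : ℝ → Plane} {x : Plane} {T : Set Plane}

theorem leftSide_subset_compl_range (γ : ℝ → Plane) : leftSide γ ⊆ (range γ)ᶜ := fun _ hx => hx.1

theorem rightSide_subset_compl_range (γ : ℝ → Plane) : rightSide γ ⊆ (range γ)ᶜ :=
  range_reverse γ ▸ leftSide_subset_compl_range _

theorem leftSide_eq_connectedComponentIn (hx : x ∈ leftSide γ) :
    leftSide γ = connectedComponentIn (range γ)ᶜ x := by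
  ext y
  refine ⟨fun ⟨hy, hlim⟩ => ?_, fun hy => ⟨connectedComponentIn_subset _ x hy, ?_⟩⟩
  · obtain ⟨ε, hεy, hεx⟩ := (hlim.and hx.2).exists
    rw [connectedComponentIn_eq hεx, ← connectedComponentIn_eq hεy]
    exact mem_connectedComponentIn hy
  · rw [← connectedComponentIn_eq hy]
    exact hx.2

theorem subset_leftSide (hT : IsPreconnected T) (hTγ : T ⊆ (range γ)ᶜ) (hx : x ∈ T)
    (hxl : x ∈ leftSide γ) : T ⊆ leftSide γ := by
  rw [leftSide_eq_connectedComponentIn hxl]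
  exact hT.subset_connectedComponentIn hx hTγ

end PlaneCurve

namespace IsSimpleClosedSmoothRegularCurve

open Set Filter Topology PlaneCurve

variable {γ : ℝ → Plane} {ℓ κ t a b : ℝ} {x y : Plane} {T : Set Plane}
variable (hγ : IsSimpleClosedSmoothRegularCurve γ ℓ)
include hγ

section Sides

theorem eventually_mem_leftSide (t : ℝ) :
    ∀ᶠ ε : ℝ in 𝓝[>] 0, γ t + ε • normal γ t ∈ leftSide γ := by
  obtain ⟨κ, hκ⟩ := hγ.exists_forall_supportedFromLeft
  have hev : ∀ᶠ ε : ℝ in 𝓝[>] 0, κ * ε < 2 := nhdsWithin_le_nhds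
    ((by fun_prop : Continuous fun ε : ℝ => κ * ε).continuousAt.eventually_lt_const (by simp))
  obtain ⟨r, hr, hsub⟩ := mem_nhdsGT_iff_exists_Ioo_subset.1 hev
  set L := (fun p : ℝ × ℝ => γ p.1 + p.2 • normal γ p.1) '' (univ ×ˢ Ioo 0 r)
  have hγc := hγ.smooth.continuous
  have hNc := (contDiff_normal hγ.smooth hγ.regular).continuous
  have hL : IsPreconnected L := (isPreconnected_univ.prod isPreconnected_Ioo).image _ <|
    Continuous.continuousOn (by fun_prop)
  have hmem (s) {ε} (hε : ε ∈ Ioo 0 r) : γ s + ε • normal γ s ∈ L := ⟨(s, ε), ⟨trivial, hε⟩, rfl⟩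
  have hLγ : L ⊆ (range γ)ᶜ := by
    rintro _ ⟨⟨s, ε⟩, ⟨-, hε⟩, rfl⟩ ⟨u, hu⟩
    have hle := hκ s u
    rw [hu, circlineFun_add_smul, norm_normal (hγ.regular s)] at hle
    nlinarith [hε.1, mem_ofPred_eq ▸ hsub hε]
  filter_upwards [Ioo_mem_nhdsGT hr] with ε hε
  refine ⟨hLγ (hmem t hε), ?_⟩
  filter_upwards [Ioo_mem_nhdsGT hr] with δ hδ
  exact hL.subset_connectedComponentIn (hmem t hε) hLγ (hmem 0 hδ)

theorem isPreconnected_leftSide : IsPreconnected (leftSide γ) := by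
  obtain ⟨ε, hε⟩ := (hγ.eventually_mem_leftSide 0).exists
  rw [leftSide_eq_connectedComponentIn hε]
  exact isPreconnected_connectedComponentIn

theorem mem_leftSide_of_circlineFun_nonneg (hsupp : SupportedFromLeft γ κ t) (hx : x ∉ range γ)
    (hx0 : 0 ≤ circlineFun κ (normal γ t) (γ t) x) : x ∈ leftSide γ := by
  have hn := normal_ne_zero (hγ.regular t)
  set D := {y | 0 < circlineFun κ (normal γ t) (γ t) y}
  have hD : D ⊆ (range γ)ᶜ := by
    rintro _ hy ⟨s, rfl⟩
    exact (hsupp s).not_gt hy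
  have hxD : insert x D ⊆ closure D :=
    insert_subset (setOf_circlineFun_nonneg_subset_closure hn κ (γ t) hx0) subset_closure
  obtain ⟨ε, hεl, hεD⟩ := ((hγ.eventually_mem_leftSide t).and
    (eventually_circlineFun_add_smul_pos hn κ (γ t))).exists
  have hpre := (isPreconnected_setOf_circlineFun_pos one_lt_rank_plane κ (normal γ t)
    (γ t)).subset_closure (subset_insert x D) hxD
  exact subset_leftSide hpre (insert_subset hx hD) (mem_insert_of_mem x hεD) hεl (mem_insert x D)

end Sides

section Jordan

theorem isOpen_compl_range : IsOpen (range γ)ᶜ := hγ.isCompact_range.isClosed.isOpen_compl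

theorem contDiff_toComplex_comp : ContDiff ℝ 1 (toComplex ∘ γ) :=
  toComplex.toContinuousLinearEquiv.contDiff.comp hγ.contDiff_one

theorem deriv_toComplex_comp_div (t : ℝ) :
    deriv (toComplex ∘ γ) t / toComplex (normal γ t) = -‖deriv γ t‖ * Complex.I := by
  have hderiv : deriv (toComplex ∘ γ) t = toComplex (deriv γ t) :=
    (toComplex.toContinuousLinearEquiv.hasFDerivAt.comp_hasDerivAt t
      (hγ.contDiff_one.differentiable one_ne_zero t).hasDerivAt).deriv
  have hT : toComplex (tangent γ t) ≠ 0 := by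
    rw [← norm_ne_zero_iff, LinearIsometryEquiv.norm_map, norm_tangent (hγ.regular t)]
    exact one_ne_zero
  rw [hderiv, normal, toComplex_rotate, ← norm_deriv_smul_tangent γ t, map_smul,
    Complex.real_smul, div_eq_iff (mul_ne_zero Complex.I_ne_zero hT), norm_smul, norm_norm,
    norm_tangent (hγ.regular t), mul_one]
  linear_combination ((‖deriv γ t‖ : ℂ) * toComplex (tangent γ t)) * Complex.I_mul_I

theorem hasCauchyJump (ht : t ∈ Ioo a b) (hab : b ≤ a + ℓ) :
    HasCauchyJump (toComplex ∘ γ) a b (toComplex (γ t)) (toComplex (normal γ t))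
      (2 * Real.pi * Complex.I) := by
  refine hasCauchyJump_two_pi_I hγ.contDiff_toComplex_comp ht ?_ fun s hs heq => ?_
  · rw [hγ.deriv_toComplex_comp_div]
    simpa using hγ.regular t
  · rw [Function.comp_apply, Function.comp_apply, toComplex.injective.eq_iff] at heq
    rcases le_total t s with hts | hst
    · exact hγ.eq_of_mem_Ico ⟨hts, by linarith [ht.1, hs.2]⟩ heq
    · exact (hγ.eq_of_mem_Ico ⟨hst, by linarith [ht.2, hs.1]⟩ heq.symm).symm

theorem cauchyIntegral_period_eq (hT : IsPreconnected T) (hTγ : T ⊆ (range γ)ᶜ) (hx : x ∈ T)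
    (hy : y ∈ T) : cauchyIntegral (toComplex ∘ γ) (-(ℓ / 2)) (ℓ / 2) (toComplex x) =
      cauchyIntegral (toComplex ∘ γ) (-(ℓ / 2)) (ℓ / 2) (toComplex y) := by
  refine eq_of_hasDerivAt_zero (U := toComplex '' (range γ)ᶜ)
    (toComplex.toHomeomorph.isOpenMap _ hγ.isOpen_compl_range) ?_
    (hT.image _ toComplex.continuous.continuousOn) (image_mono hTγ) (mem_image_of_mem _ hx)
    (mem_image_of_mem _ hy)
  rintro _ ⟨z, hz, rfl⟩
  refine (hasDerivAt_cauchyIntegral hγ.contDiff_toComplex_comp ?_).congr_deriv ?_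
  · rintro ⟨s, -, hs⟩
    exact hz ⟨s, toComplex.injective hs⟩
  · rw [Function.comp_apply, Function.comp_apply, ← hγ.periodic (-(ℓ / 2)),
      show -(ℓ / 2) + ℓ = ℓ / 2 by ring, sub_self]

theorem eventually_mem_rightSide (t : ℝ) :
    ∀ᶠ ε : ℝ in 𝓝[>] 0, γ t - ε • normal γ t ∈ rightSide γ := by
  simpa [rightSide, normal_reverse, PlaneCurve.reverse, ← sub_eq_add_neg]
    using hγ.reverse.eventually_mem_leftSide (-t)

theorem disjoint_leftSide_rightSide : Disjoint (leftSide γ) (rightSide γ) := by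
  refine disjoint_left.2 fun x hl hr => Complex.two_pi_I_ne_zero ?_
  have hjump := (hγ.hasCauchyJump (t := 0) (a := -(ℓ / 2)) (b := ℓ / 2)
    ⟨by linarith [hγ.period_pos], by linarith [hγ.period_pos]⟩ (by linarith)).2
  refine tendsto_nhds_unique hjump (tendsto_const_nhds.congr' ?_)
  filter_upwards [hγ.eventually_mem_leftSide 0, hγ.eventually_mem_rightSide 0] with ε hεl hεr
  rw [← Complex.real_smul, ← map_smul, ← map_add, ← map_sub, eq_comm, sub_eq_zero,
    hγ.cauchyIntegral_period_eq hγ.isPreconnected_leftSide (leftSide_subset_compl_range γ) hεl hl,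
    hγ.cauchyIntegral_period_eq hγ.reverse.isPreconnected_leftSide (rightSide_subset_compl_range γ)
      hεr hr]

theorem exists_eq_add_smul_normal (x : Plane) :
    ∃ t a, x = γ t + a • normal γ t ∧ ∀ s, |a| ≤ dist x (γ s) := by
  obtain ⟨-, ⟨t, rfl⟩, ht⟩ := hγ.isCompact_range.exists_infDist_eq_dist (range_nonempty γ) x
  have hmin (s) : dist x (γ t) ≤ dist x (γ s) := ht ▸ Metric.infDist_le_dist_of_mem ⟨s, rfl⟩
  have horth : inner ℝ (tangent γ t) (x - γ t) = 0 := by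
    have hloc : IsLocalMin (fun s => ‖x - γ s‖ ^ 2) t := Eventually.of_forall fun s => by
      simpa only [dist_eq_norm] using pow_le_pow_left₀ dist_nonneg (hmin s) 2
    have hderiv := hloc.hasDerivAt_eq_zero
      (((hγ.contDiff_one.differentiable one_ne_zero t).hasDerivAt.const_sub x).norm_sq)
    rw [inner_neg_right, real_inner_comm] at hderiv
    rw [tangent, real_inner_smul_left]
    linear_combination (-‖deriv γ t‖⁻¹ / 2) * hderiv
  have hdecomp := eq_inner_smul_add_inner_smul_rotate (norm_tangent (hγ.regular t)) (x - γ t)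
  rw [horth, zero_smul, zero_add, ← normal] at hdecomp
  refine ⟨t, _, sub_eq_iff_eq_add'.1 hdecomp, fun s => le_of_eq_of_le ?_ (hmin s)⟩
  rw [dist_eq_norm, hdecomp, norm_smul, norm_normal (hγ.regular t), mul_one, ← hdecomp,
    Real.norm_eq_abs]

theorem mem_leftSide_of_forall_le_dist (ha : 0 < a)
    (hmin : ∀ s, a ≤ dist (γ t + a • normal γ t) (γ s)) : γ t + a • normal γ t ∈ leftSide γ := by
  obtain ⟨ε, hεl, hε⟩ := ((hγ.eventually_mem_leftSide t).and (Ioo_mem_nhdsGT ha)).exists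
  refine subset_leftSide (convex_ball _ a).isPreconnected ?_ ?_ hεl (Metric.mem_ball_self ha)
  · rintro _ hs ⟨s, rfl⟩
    exact (hmin s).not_gt (Metric.mem_ball'.1 hs)
  · rw [Metric.mem_ball, dist_add_left, dist_eq_norm, ← sub_smul, norm_smul,
      norm_normal (hγ.regular t), mul_one, Real.norm_of_nonpos (by linarith [hε.2])]
    linarith [hε.1]

theorem leftSide_union_rightSide : leftSide γ ∪ rightSide γ = (range γ)ᶜ := by
  refine Subset.antisymm (union_subset (leftSide_subset_compl_range γ)
    (rightSide_subset_compl_range γ)) fun x hx => ?_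
  obtain ⟨t, a, rfl, hmin⟩ := hγ.exists_eq_add_smul_normal x
  rcases lt_trichotomy a 0 with ha | rfl | ha
  · refine Or.inr ?_
    have := hγ.reverse.mem_leftSide_of_forall_le_dist (t := -t) (a := -a) (neg_pos.2 ha)
    simp only [normal_reverse, PlaneCurve.reverse, neg_neg, neg_smul_neg] at this
    exact this fun s => abs_of_neg ha ▸ hmin (-s)
  · exact absurd ⟨t, by simp⟩ hx
  · exact Or.inl (hγ.mem_leftSide_of_forall_le_dist ha fun s => (le_abs_self a).trans (hmin s))

theorem exists_unbounded_subset_compl_range :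
    ∃ V, IsPreconnected V ∧ V ⊆ (range γ)ᶜ ∧ Bornology.IsBounded Vᶜ ∧ ¬ Bornology.IsBounded V := by
  obtain ⟨r, hr⟩ := hγ.isCompact_range.isBounded.subset_closedBall (0 : Plane)
  have hbdd : Bornology.IsBounded (Metric.closedBall (0 : Plane) r)ᶜᶜ := by
    rw [compl_compl]
    exact Metric.isBounded_closedBall
  exact ⟨_, isPreconnected_compl_closedBall one_lt_rank_plane 0 r, compl_subset_compl.2 hr, hbdd,
    fun h => NoncompactSpace.noncompact_univ (X := Plane) (by
      simpa [Metric.isCompact_iff_isClosed_bounded] using h.union hbdd)⟩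

theorem isBounded_leftSide_iff :
    Bornology.IsBounded (leftSide γ) ↔ ¬ Bornology.IsBounded (rightSide γ) := by
  obtain ⟨V, hV, hVγ, hVc, hVu⟩ := hγ.exists_unbounded_subset_compl_range
  obtain ⟨x, hx⟩ : V.Nonempty :=
    nonempty_iff_ne_empty.2 fun h => hVu (h ▸ Bornology.isBounded_empty)
  have hdisj := hγ.disjoint_leftSide_rightSide
  rcases hγ.leftSide_union_rightSide.ge (hVγ hx) with hl | hr
  · have hVl := subset_leftSide hV hVγ hx hl
    exact iff_of_false (fun h => hVu (h.subset hVl)) (not_not_intro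
      (hVc.subset (hdisj.mono_left hVl).subset_compl_left))
  · have hVr := subset_leftSide hV ((range_reverse γ).symm ▸ hVγ) hx hr
    exact iff_of_true (hVc.subset (hdisj.mono_right hVr).subset_compl_right)
      fun h => hVu (h.subset hVr)

theorem leftSide_eq_inside (hb : Bornology.IsBounded (leftSide γ)) :
    leftSide γ = inside (range γ) := by
  refine Subset.antisymm (fun x hx => ⟨hx.1, leftSide_eq_connectedComponentIn hx ▸ hb⟩)
    fun x hx => (hγ.leftSide_union_rightSide.ge hx.1).resolve_right fun hxr => ?_
  refine hγ.isBounded_leftSide_iff.1 hb ?_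
  rw [rightSide, leftSide_eq_connectedComponentIn hxr, range_reverse]
  exact hx.2

theorem leftSide_eq_outside (hb : ¬ Bornology.IsBounded (leftSide γ)) :
    leftSide γ = outside (range γ) := by
  refine Subset.antisymm (fun x hx => ⟨hx.1, leftSide_eq_connectedComponentIn hx ▸ hb⟩)
    fun x hx => (hγ.leftSide_union_rightSide.ge hx.1).resolve_right fun hxr => ?_
  refine hx.2 ?_
  rw [← range_reverse, ← leftSide_eq_connectedComponentIn hxr, ← rightSide]
  exact not_not.1 (hγ.isBounded_leftSide_iff.not.1 hb)

theorem sides_eq_inside_outside :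
    leftSide γ = inside (range γ) ∧ rightSide γ = outside (range γ) ∨
      leftSide γ = outside (range γ) ∧ rightSide γ = inside (range γ) := by
  rw [← range_reverse γ]
  by_cases hb : Bornology.IsBounded (leftSide γ)
  · exact Or.inl ⟨range_reverse γ ▸ hγ.leftSide_eq_inside hb,
      hγ.reverse.leftSide_eq_outside (hγ.isBounded_leftSide_iff.1 hb)⟩
  · exact Or.inr ⟨range_reverse γ ▸ hγ.leftSide_eq_outside hb,
      hγ.reverse.leftSide_eq_inside (not_not.1 (hγ.isBounded_leftSide_iff.not.1 hb))⟩

end Jordan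

end IsSimpleClosedSmoothRegularCurve

namespace PlaneCurve

open Set Filter Topology

section PrimitiveOffArc

open Complex

variable {κ₁ κ₂ : ℝ} {n₁ p₁ n₂ p₂ A B r x : ℂ}

theorem inner_mul_mul_left (u z w : ℂ) : inner ℝ (u * z) (u * w) = ‖u‖ ^ 2 * inner ℝ z w := by
  simp only [Complex.inner, ← normSq_eq_norm_sq, normSq_apply, map_mul, mul_re, mul_im, conj_re,
    conj_im]
  ring

theorem exists_circlineFun_cross (κ : ℝ) (n p A B : ℂ) : ∃ L : ℂ →ₗ[ℝ] ℝ, ∀ x u : ℂ,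
    u * (A - x) = B - x → ‖1 - u‖ ^ 2 * circlineFun κ n p x =
      ‖u‖ ^ 2 * circlineFun κ n p A + L u + circlineFun κ n p B := by
  refine ⟨IsLinearMap.mk' (fun u => 2 * (κ * inner ℝ (B - p) (u * (A - p)) -
    inner ℝ n (u * (A - p)) - inner ℝ (u * n) (B - p))) ⟨fun u v => ?_, fun a u => ?_⟩,
    fun x u h => ?_⟩
  · simp only [add_mul, inner_add_left, inner_add_right]
    ring
  · simp only [smul_mul_assoc, real_inner_smul_left, real_inner_smul_right, smul_eq_mul]
    ring
  · have hx : (1 - u) * (x - p) = (B - p) - u * (A - p) := by linear_combination h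
    rw [circlineFun, mul_sub, mul_left_comm, ← inner_mul_mul_left, mul_left_comm, ← mul_pow,
      ← norm_mul, hx, norm_sub_sq_real, norm_mul, mul_pow, sub_mul, one_mul, inner_sub_left,
      inner_sub_right n (B - p), inner_sub_right (u * n) (B - p), inner_mul_mul_left]
    simp only [circlineFun, IsLinearMap.mk'_apply]
    ring

theorem exists_ne_zero_apply_eq_zero_apply_nonpos {E : Type*} [AddCommGroup E] [Module ℝ E]
    (hE : 1 < Module.finrank ℝ E) (L₁ L₂ : E →ₗ[ℝ] ℝ) : ∃ r ≠ 0, L₁ r = 0 ∧ L₂ r ≤ 0 := by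
  have : FiniteDimensional ℝ E := .of_finrank_pos (zero_lt_one.trans hE)
  obtain ⟨r, hr, hr0⟩ := Submodule.exists_mem_ne_zero_of_ne_bot
    (LinearMap.ker_ne_bot_of_finrank_lt (f := L₁) (by rwa [Module.finrank_self]))
  rcases le_total (L₂ r) 0 with h | h
  · exact ⟨r, hr0, hr, h⟩
  · exact ⟨-r, neg_ne_zero.2 hr0, by rw [map_neg, hr, neg_zero], by rwa [map_neg, neg_nonpos]⟩

theorem hasDerivAt_log_neg_div_div (hx : x ≠ A)
    (hslit : -((B - x) / (A - x)) / r ∈ slitPlane) :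
    HasDerivAt (fun y => log (-((B - y) / (A - y)) / r)) (1 / (A - x) - 1 / (B - x)) x := by
  have hA : A - x ≠ 0 := sub_ne_zero.2 hx.symm
  obtain ⟨hneg, hr⟩ := div_ne_zero_iff.1 (slitPlane_ne_zero hslit)
  have hB : B - x ≠ 0 := (div_ne_zero_iff.1 (neg_ne_zero.1 hneg)).1
  have hdiv : HasDerivAt (fun y => -((B - y) / (A - y)) / r)
      (-((-1 * (A - x) - (B - x) * -1) / (A - x) ^ 2) / r) x :=
    (((hasDerivAt_id x).const_sub B).div ((hasDerivAt_id x).const_sub A) hA).neg.div_const r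
  refine (hdiv.clog hslit).congr_deriv ?_
  field_simp
  ring

theorem exists_eq_ofReal_mul_of_neg_div_notMem_slitPlane {u : ℂ} (hr : r ≠ 0)
    (hu : -u / r ∉ slitPlane) : ∃ l : ℝ, 0 ≤ l ∧ u = l * r := by
  rw [mem_slitPlane_iff, not_or, not_lt, not_not] at hu
  refine ⟨-(-u / r).re, neg_nonneg.2 hu.1, ?_⟩
  have hreal : ((-u / r).re : ℂ) = -u / r := Complex.ext (ofReal_re _) (by rw [ofReal_im, hu.2])
  rw [ofReal_neg, hreal]
  field_simp

/-- In the coordinate `u = (B - x) / (A - x)` the two arcs from `A` to `B` of a circline become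
opposite rays from the origin, so a branch of `log u` is a primitive off one of them. -/
theorem exists_hasDerivAt_off_arc (hAB : A ≠ B) (hA₁ : circlineFun κ₁ n₁ p₁ A = 0)
    (hB₁ : circlineFun κ₁ n₁ p₁ B = 0) (hA₂ : circlineFun κ₂ n₂ p₂ A ≤ 0)
    (hB₂ : circlineFun κ₂ n₂ p₂ B ≤ 0) :
    ∃ G : ℂ → ℂ, ∀ x ≠ A, circlineFun κ₁ n₁ p₁ x ≠ 0 ∨ 0 < circlineFun κ₂ n₂ p₂ x →
      HasDerivAt G (1 / (A - x) - 1 / (B - x)) x := by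
  obtain ⟨L₁, hL₁⟩ := exists_circlineFun_cross κ₁ n₁ p₁ A B
  obtain ⟨L₂, hL₂⟩ := exists_circlineFun_cross κ₂ n₂ p₂ A B
  obtain ⟨r, hr, hr₁, hr₂⟩ := exists_ne_zero_apply_eq_zero_apply_nonpos
    (by rw [finrank_real_complex]; exact one_lt_two) L₁ L₂
  refine ⟨fun x => log (-((B - x) / (A - x)) / r), fun x hx hfx =>
    hasDerivAt_log_neg_div_div hx ?_⟩
  by_contra hslit
  obtain ⟨l, hl, hu⟩ := exists_eq_ofReal_mul_of_neg_div_notMem_slitPlane hr hslit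
  have hul : l • r * (A - x) = B - x := by
    rw [real_smul, ← hu, div_mul_cancel₀ _ (sub_ne_zero.2 hx.symm)]
  have hpos : 0 < ‖1 - l • r‖ ^ 2 := by
    refine pow_pos (norm_pos_iff.2 fun h => hAB ?_) 2
    rwa [← sub_eq_zero.1 h, one_mul, sub_left_inj] at hul
  have hx₁ := hL₁ x _ hul
  have hx₂ := hL₂ x _ hul
  rw [map_smul, hr₁, hA₁, hB₁, smul_zero, mul_zero, add_zero, add_zero, mul_eq_zero] at hx₁
  refine hfx.elim (fun h => h (hx₁.resolve_left hpos.ne')) fun h => ?_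
  have hlin : L₂ (l • r) ≤ 0 := by
    rw [map_smul]
    exact mul_nonpos_of_nonneg_of_nonpos hl hr₂
  linarith [mul_pos hpos h, mul_nonpos_of_nonneg_of_nonpos (sq_nonneg ‖l • r‖) hA₂]

end PrimitiveOffArc

/-- The function whose zero set is the largest supporting circline that is tangent to the closed
curve `γ` of period `ℓ` at `t` from the left; it is positive on the left of this circline. -/
noncomputable def supportFun (γ : ℝ → Plane) (ℓ t : ℝ) : Plane → ℝ :=
  circlineFun (maxCurvature γ ℓ t) (normal γ t) (γ t)

/-- The largest supporting circline that is tangent to `γ` at `t` from the left passes through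
`γ s`. -/
def Touches (γ : ℝ → Plane) (ℓ t s : ℝ) : Prop := supportFun γ ℓ t (γ s) = 0

@[simp]
theorem supportFun_self (γ : ℝ → Plane) (ℓ t : ℝ) : supportFun γ ℓ t (γ t) = 0 :=
  circlineFun_self _ _ _

theorem continuous_supportFun (γ : ℝ → Plane) (ℓ t : ℝ) : Continuous (supportFun γ ℓ t) :=
  continuous_circlineFun _ _ _

end PlaneCurve

namespace IsSimpleClosedSmoothRegularCurve

open Set Filter Topology PlaneCurve

variable {γ : ℝ → Plane} {ℓ κ t s r a m b : ℝ} {x : Plane} {T : Set Plane}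
variable (hγ : IsSimpleClosedSmoothRegularCurve γ ℓ)
include hγ

section Touches

theorem supportFun_apply_nonpos (t s : ℝ) : supportFun γ ℓ t (γ s) ≤ 0 :=
  hγ.supportedFromLeft_maxCurvature t s

theorem touches_add_period : Touches γ ℓ t (s + ℓ) ↔ Touches γ ℓ t s := by
  rw [Touches, hγ.periodic, Touches]

theorem normal_sub_smul_of_circlineFun_eq_zero (hsupp : SupportedFromLeft γ κ t)
    (h : circlineFun κ (normal γ t) (γ t) (γ s) = 0) :
    normal γ t - κ • (γ s - γ t) = normal γ s := by
  set n := normal γ t - κ • (γ s - γ t)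
  have hn : ‖n‖ = 1 := by
    rw [← sq_eq_sq₀ (norm_nonneg _) zero_le_one, norm_sub_smul_sq, h, norm_normal (hγ.regular t),
      mul_zero, sub_zero]
  have hcirc (y) : circlineFun κ n (γ s) y = circlineFun κ (normal γ t) (γ t) y := by
    rw [circlineFun_sub_smul, h, sub_zero]
  have hmax : IsLocalMax (fun r => circlineFun κ (normal γ t) (γ t) (γ r)) s :=
    Eventually.of_forall fun r => (hsupp r).trans_eq h.symm
  have horth : inner ℝ (tangent γ s) n = 0 := by
    have hderiv := hmax.hasDerivAt_eq_zero (hasDerivAt_circlineFun_comp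
      (hγ.contDiff_one.differentiable one_ne_zero s).hasDerivAt κ (normal γ t) (γ t))
    rw [tangent, real_inner_smul_left, real_inner_comm, (mul_eq_zero.1 hderiv).resolve_left
      two_ne_zero, mul_zero]
  refine (eq_rotate_or_eq_neg_rotate (norm_tangent (hγ.regular s)) hn horth).resolve_right
    fun hneg => ?_
  have hn0 : n ≠ 0 := norm_ne_zero_iff.1 (hn ▸ one_ne_zero)
  obtain ⟨ε, hεr, hε⟩ := ((hγ.eventually_mem_rightSide s).and
    (eventually_circlineFun_add_smul_pos hn0 κ (γ s))).exists
  rw [hcirc, hneg, ← normal, smul_neg, ← sub_eq_add_neg] at hε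
  exact disjoint_left.1 hγ.disjoint_leftSide_rightSide (hγ.mem_leftSide_of_circlineFun_nonneg hsupp
    (rightSide_subset_compl_range γ hεr) hε.le) hεr

theorem supportFun_eq (h : Touches γ ℓ t s) : supportFun γ ℓ s = supportFun γ ℓ t := by
  have hn := hγ.normal_sub_smul_of_circlineFun_eq_zero (hγ.supportedFromLeft_maxCurvature t) h
  have hcirc (y) : circlineFun (maxCurvature γ ℓ t) (normal γ s) (γ s) y = supportFun γ ℓ t y := by
    rw [← hn, circlineFun_sub_smul, show circlineFun _ _ _ _ = (0 : ℝ) from h, sub_zero, supportFun]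
  suffices heq : maxCurvature γ ℓ s = maxCurvature γ ℓ t by
    funext y
    rw [← hcirc, ← heq, supportFun]
  refine le_antisymm (hγ.supportedFromLeft_iff.1 fun r => ?_) ?_
  · rw [hcirc]
    exact hγ.supportFun_apply_nonpos t r
  · rcases eq_or_ne (γ s) (γ t) with hst | hst
    · rw [hst, sub_self, smul_zero, sub_zero] at hn
      refine hγ.supportedFromLeft_iff.1 fun r => ?_
      rw [hn, ← hst]
      exact hγ.supportFun_apply_nonpos s r
    · have hle := hγ.supportFun_apply_nonpos s t
      rw [supportFun, circlineFun_eq_add _ (maxCurvature γ ℓ t), hcirc, supportFun_self, zero_add]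
        at hle
      have hpos := pow_pos (norm_pos_iff.2 (sub_ne_zero.2 hst.symm)) 2
      exact sub_nonpos.1 (nonpos_of_mul_nonpos_left hle hpos)

theorem touches_symm (h : Touches γ ℓ t s) : Touches γ ℓ s t := by
  rw [Touches, hγ.supportFun_eq h, supportFun_self]

theorem touches_trans (h : Touches γ ℓ t s) (h' : Touches γ ℓ s r) : Touches γ ℓ t r := by
  rwa [Touches, ← hγ.supportFun_eq h]

theorem eventually_supportFun_add_smul_pos (h : Touches γ ℓ t s) :
    ∀ᶠ ε : ℝ in 𝓝[>] 0, 0 < supportFun γ ℓ t (γ s + ε • normal γ s) := by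
  rw [← hγ.supportFun_eq h]
  exact eventually_circlineFun_add_smul_pos (normal_ne_zero (hγ.regular s)) _ _

theorem rightSide_subset_setOf_supportFun_ne_zero (t : ℝ) :
    rightSide γ ⊆ {x | supportFun γ ℓ t x ≠ 0} := fun _ hx h =>
  disjoint_left.1 hγ.disjoint_leftSide_rightSide (hγ.mem_leftSide_of_circlineFun_nonneg
    (hγ.supportedFromLeft_maxCurvature t)
    (rightSide_subset_compl_range γ hx) h.ge) hx

theorem maxCurvature_eq_or_exists_touches (t : ℝ) :
    maxCurvature γ ℓ t = signedCurvature γ t ∨ ∃ s ∈ Ioo t (t + ℓ), Touches γ ℓ t s := by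
  obtain ⟨h, hh, heq⟩ := hγ.exists_chordCurvature_eq_maxCurvature t
  have hhℓ := hγ.Icc_half_period_subset hh
  rcases eq_or_ne h 0 with rfl | h0
  · exact Or.inl (by rw [← heq, chordCurvature_zero hγ.smooth hγ.regular])
  · have htouch : Touches γ ℓ t (t + h) := (hγ.circlineFun_eq_zero_iff hhℓ h0).2 heq
    rcases h0.lt_or_gt with hneg | hpos
    · exact Or.inr ⟨t + h + ℓ, ⟨by linarith [hhℓ.1], by linarith⟩, hγ.touches_add_period.2 htouch⟩
    · exact Or.inr ⟨t + h, ⟨by linarith, by linarith [hhℓ.2]⟩, htouch⟩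

end Touches

end IsSimpleClosedSmoothRegularCurve

namespace PlaneCurve

open Filter Topology

theorem HasCauchyJump.tendsto_sub {c : ℝ → ℂ} {a b : ℝ} {p w L : ℂ} {G : ℂ → ℂ}
    (h : HasCauchyJump c a b p w L) (hG : ContinuousAt G p) :
    Tendsto (fun ε : ℝ => cauchyIntegral c a b (p + ε * w) - G (p + ε * w) -
      (cauchyIntegral c a b (p - ε * w) - G (p - ε * w))) (𝓝[>] 0) (𝓝 L) := by
  have hG' := (hG.tendsto.comp (tendsto_add_mul_nhdsGT_zero p w)).sub
    (hG.tendsto.comp (tendsto_sub_mul_nhdsGT_zero p w))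
  rw [sub_self] at hG'
  refine (sub_zero L ▸ h.2.sub hG').congr fun ε => ?_
  simp only [Function.comp_apply]
  ring

end PlaneCurve

namespace IsSimpleClosedSmoothRegularCurve

open Set Filter Topology PlaneCurve

variable {γ : ℝ → Plane} {ℓ t s a m b : ℝ}
variable (hγ : IsSimpleClosedSmoothRegularCurve γ ℓ)
include hγ

section Interleaving

theorem apply_ne_of_mem_Ioo (hs : s ∈ Ioo t (t + ℓ)) : γ s ≠ γ t := fun h =>
  hs.1.ne' (hγ.eq_of_mem_Ico (Ioo_subset_Ico_self hs) h)

theorem setOf_supportFun_pos_subset_compl_range (t : ℝ) :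
    {x | 0 < supportFun γ ℓ t x} ⊆ (range γ)ᶜ := by
  rintro _ hx ⟨s, rfl⟩
  exact (hγ.supportFun_apply_nonpos t s).not_gt hx

theorem exists_forall_hasDerivAt (hb : b ∈ Ioo a (a + ℓ)) (hab : Touches γ ℓ a b) (m : ℝ) :
    ∃ G : ℂ → ℂ, ∀ x ≠ γ a, supportFun γ ℓ a x ≠ 0 ∨ 0 < supportFun γ ℓ m x →
      HasDerivAt G (1 / (toComplex (γ a) - toComplex x) - 1 / (toComplex (γ b) - toComplex x))
        (toComplex x) := by
  have hmap (t) (x : Plane) : circlineFun (maxCurvature γ ℓ t) (toComplex (normal γ t))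
      (toComplex (γ t)) (toComplex x) = supportFun γ ℓ t x :=
    circlineFun_map toComplex.toLinearIsometry _ _ _ _
  obtain ⟨G, hG⟩ := exists_hasDerivAt_off_arc
    (toComplex.injective.ne (hγ.apply_ne_of_mem_Ioo hb).symm)
    ((hmap a (γ a)).trans (supportFun_self γ ℓ a)) ((hmap a (γ b)).trans hab)
    ((hmap m (γ a)).trans_le (hγ.supportFun_apply_nonpos m a))
    ((hmap m (γ b)).trans_le (hγ.supportFun_apply_nonpos m b))
  refine ⟨G, fun x hx hfx => hG _ (toComplex.injective.ne hx) ?_⟩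
  rwa [hmap, hmap]

theorem cauchyIntegral_sub_eq {G : ℂ → ℂ} {T : Set Plane} {x y : Plane}
    (hG : ∀ x ≠ γ a, supportFun γ ℓ a x ≠ 0 ∨ 0 < supportFun γ ℓ m x → HasDerivAt G
      (1 / (toComplex (γ a) - toComplex x) - 1 / (toComplex (γ b) - toComplex x)) (toComplex x))
    (hT : IsPreconnected T) (hTγ : T ⊆ (range γ)ᶜ)
    (hT' : T ⊆ {x | supportFun γ ℓ a x ≠ 0 ∨ 0 < supportFun γ ℓ m x}) (hx : x ∈ T) (hy : y ∈ T) :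
    cauchyIntegral (toComplex ∘ γ) a b (toComplex x) - G (toComplex x) =
      cauchyIntegral (toComplex ∘ γ) a b (toComplex y) - G (toComplex y) := by
  have hU : IsOpen ((range γ)ᶜ ∩ {x | supportFun γ ℓ a x ≠ 0 ∨ 0 < supportFun γ ℓ m x}) :=
    hγ.isOpen_compl_range.inter
      ((isOpen_ne_fun (continuous_supportFun γ ℓ a) continuous_const).union
        (isOpen_lt continuous_const (continuous_supportFun γ ℓ m)))
  refine eq_of_hasDerivAt_zero (f := fun z => cauchyIntegral (toComplex ∘ γ) a b z - G z)
    (toComplex.toHomeomorph.isOpenMap _ hU) ?_ (hT.image _ toComplex.continuous.continuousOn)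
    (image_mono (subset_inter hTγ hT')) (mem_image_of_mem _ hx) (mem_image_of_mem _ hy)
  rintro _ ⟨z, ⟨hzγ, hz⟩, rfl⟩
  refine ((hasDerivAt_cauchyIntegral hγ.contDiff_toComplex_comp ?_).sub
    (hG z ?_ hz)).congr_deriv (sub_self _)
  · rintro ⟨r, -, heq⟩
    exact hzγ ⟨r, toComplex.injective heq⟩
  · rintro rfl
    exact hzγ ⟨a, rfl⟩

/-- Otherwise a primitive `G` of the derivative of the Cauchy integral over `[a, b]` could be chosen
such that their difference is constant both on the open supporting disk at `m` and on the right side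
of the curve; but both of these approach the curve at `m`, where the difference jumps, and at `s`,
where it does not. -/
theorem touches_of_interleaved (ham : a < m) (hmb : m < b) (hbs : b < s) (hsa : s < a + ℓ)
    (hab : Touches γ ℓ a b) (hms : Touches γ ℓ m s) : Touches γ ℓ a m := by
  by_contra hcon
  have has : ¬ Touches γ ℓ a s := fun h => hcon (hγ.touches_trans h (hγ.touches_symm hms))
  obtain ⟨G, hG⟩ := hγ.exists_forall_hasDerivAt ⟨by linarith, by linarith⟩ hab m
  have hsγ : toComplex (γ s) ∉ (toComplex ∘ γ) '' uIcc a b := by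
    rw [image_comp, toComplex.injective.mem_set_image, uIcc_of_le (ham.trans hmb).le]
    rintro ⟨r, hr, heq⟩
    exact hγ.apply_ne_of_mem_Ioo ⟨by linarith [hr.2], by linarith [hr.1]⟩ heq.symm
  have hjump_m := (hγ.hasCauchyJump ⟨ham, hmb⟩ (by linarith)).tendsto_sub
    (hG (γ m) (hγ.apply_ne_of_mem_Ioo ⟨ham, by linarith⟩) (Or.inl hcon)).continuousAt
  have hjump_s := (hasCauchyJump_zero hγ.contDiff_toComplex_comp hsγ
    (toComplex (normal γ s))).tendsto_sub
    (hG (γ s) (hγ.apply_ne_of_mem_Ioo ⟨by linarith, hsa⟩) (Or.inl has)).continuousAt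
  refine Complex.two_pi_I_ne_zero (tendsto_nhds_unique hjump_m (hjump_s.congr' ?_))
  filter_upwards [hγ.eventually_supportFun_add_smul_pos hms,
    hγ.eventually_supportFun_add_smul_pos (supportFun_self γ ℓ m), hγ.eventually_mem_rightSide s,
    hγ.eventually_mem_rightSide m] with ε hdisk_s hdisk_m hright_s hright_m
  simp only [← Complex.real_smul, ← map_smul, ← map_add, ← map_sub]
  rw [hγ.cauchyIntegral_sub_eq hG (isPreconnected_setOf_circlineFun_pos one_lt_rank_plane _ _ _)
      (hγ.setOf_supportFun_pos_subset_compl_range m) (fun _ => Or.inr) hdisk_s hdisk_m,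
    hγ.cauchyIntegral_sub_eq hG hγ.reverse.isPreconnected_leftSide (rightSide_subset_compl_range γ)
      (fun _ hx => Or.inl (hγ.rightSide_subset_setOf_supportFun_ne_zero a hx)) hright_s hright_m]

end Interleaving

section MinimalChord

theorem touches_iff_chordCurvature_eq (hab : a < b) (hb : b < a + ℓ) :
    Touches γ ℓ a b ↔ chordCurvature γ a (b - a) = maxCurvature γ ℓ a := by
  rw [← hγ.circlineFun_eq_zero_iff ⟨by linarith, by linarith⟩ (sub_pos.2 hab).ne', add_sub_cancel]
  exact Iff.rfl

theorem isCompact_setOf_chordCurvature_eq (hb : b < a + ℓ) :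
    IsCompact {p ∈ Icc a b ×ˢ Icc a b |
      p.1 ≤ p.2 ∧ chordCurvature γ p.1 (p.2 - p.1) = maxCurvature γ ℓ p.1} := by
  set D : Set (ℝ × ℝ) := (Icc a b ×ˢ Icc a b) ∩ {p | p.1 ≤ p.2}
  have hD : IsCompact D := (isCompact_Icc.prod isCompact_Icc).inter_right
    (isClosed_le continuous_fst continuous_snd)
  have hcont : ContinuousOn
      (fun p : ℝ × ℝ => chordCurvature γ p.1 (p.2 - p.1) - maxCurvature γ ℓ p.1) D := by
    rintro ⟨x, y⟩ ⟨⟨hx, hy⟩, hxy : x ≤ y⟩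
    have hlen : y - x ∈ Ioo (-ℓ) ℓ :=
      ⟨by linarith [hγ.period_pos], by linarith [hx.1, hy.2]⟩
    exact ((ContinuousAt.comp (f := fun p : ℝ × ℝ => (p.1, p.2 - p.1))
      (continuousAt_chordCurvature hγ.smooth hγ.regular (hγ.meanVelocity_ne_zero hlen))
      (by fun_prop)).sub
      (hγ.continuous_maxCurvature.comp continuous_fst).continuousAt).continuousWithinAt
  convert! hD.of_isClosed_subset
    (hcont.preimage_isClosed_of_isClosed hD.isClosed isClosed_singleton (t := {0}))
    inter_subset_left using 1
  ext p
  simp only [D, mem_inter_iff, mem_preimage, mem_singleton_iff, sub_eq_zero, mem_ofPred_eq,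
    and_assoc]

theorem exists_minimal_touches (hab : a < b) (hb : b < a + ℓ) (h : Touches γ ℓ a b) :
    (∃ x ∈ Icc a b, maxCurvature γ ℓ x = signedCurvature γ x) ∨
      ∃ x y, a ≤ x ∧ x < y ∧ y ≤ b ∧ Touches γ ℓ x y ∧
        ∀ u v, x ≤ u → u < v → v ≤ y → Touches γ ℓ u v → y - x ≤ v - u := by
  obtain ⟨⟨x, y⟩, ⟨⟨hx, hy⟩, hxy : x ≤ y, heq⟩, hmin⟩ :=
    (hγ.isCompact_setOf_chordCurvature_eq hb).exists_isMinOn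
      ⟨(a, b), ⟨left_mem_Icc.2 hab.le, right_mem_Icc.2 hab.le⟩, hab.le,
        (hγ.touches_iff_chordCurvature_eq hab hb).1 h⟩
      (continuous_snd.sub continuous_fst).continuousOn
  rcases hxy.eq_or_lt with rfl | hlt
  · rw [sub_self, chordCurvature_zero hγ.smooth hγ.regular] at heq
    exact Or.inl ⟨x, hx, heq.symm⟩
  · refine Or.inr ⟨x, y, hx.1, hlt, hy.2, (hγ.touches_iff_chordCurvature_eq hlt
      (by linarith [hx.1, hy.2])).2 heq, fun u v hxu huv hvy huv' => ?_⟩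
    have hau := hx.1.trans hxu
    have hvb := hvy.trans hy.2
    exact hmin (a := (u, v)) ⟨⟨⟨hau, huv.le.trans hvb⟩, hau.trans huv.le, hvb⟩, huv.le,
      (hγ.touches_iff_chordCurvature_eq huv (by linarith)).1 huv'⟩

theorem maxCurvature_eq_or_exists_touches_of_mem_Ioo (hb : b < a + ℓ) (h : Touches γ ℓ a b)
    (hm : m ∈ Ioo a b) :
    maxCurvature γ ℓ m = signedCurvature γ m ∨ Touches γ ℓ a m ∨
      ∃ u v, a < u ∧ u < v ∧ v < b ∧ Touches γ ℓ u v := by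
  obtain ⟨ham, hmb⟩ := hm
  rcases hγ.maxCurvature_eq_or_exists_touches m with heq | ⟨s, ⟨hms, hsm⟩, htouch⟩
  · exact Or.inl heq
  refine Or.inr ?_
  rcases lt_trichotomy s b with hsb | rfl | hbs
  · exact Or.inr ⟨m, s, ham, hms, hsb, htouch⟩
  · exact Or.inl (hγ.touches_trans h (hγ.touches_symm htouch))
  rcases lt_trichotomy s (a + ℓ) with hsa | rfl | has
  · exact Or.inl (hγ.touches_of_interleaved ham hmb hbs hsa h htouch)
  · exact Or.inl (hγ.touches_symm (hγ.touches_add_period.1 htouch))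
  · rw [← sub_add_cancel s ℓ, hγ.touches_add_period] at htouch
    exact Or.inr ⟨s - ℓ, m, by linarith, by linarith, hmb, hγ.touches_symm htouch⟩

theorem exists_mem_Icc_maxCurvature_eq (hab : a < b) (hb : b < a + ℓ) (h : Touches γ ℓ a b) :
    ∃ x ∈ Icc a b, maxCurvature γ ℓ x = signedCurvature γ x := by
  rcases hγ.exists_minimal_touches hab hb h with hex | ⟨x, y, hax, hxy, hyb, htouch, hmin⟩
  · exact hex
  obtain ⟨m, hxm, hmy⟩ := exists_between hxy
  rcases hγ.maxCurvature_eq_or_exists_touches_of_mem_Ioo (by linarith) htouch ⟨hxm, hmy⟩ with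
    heq | hxm' | ⟨u, v, hxu, huv, hvy, huv'⟩
  · exact ⟨m, ⟨by linarith, by linarith⟩, heq⟩
  · linarith [hmin x m le_rfl hxm hmy.le hxm']
  · linarith [hmin u v hxu.le huv hvy.le huv']

theorem exists_mem_Ioo_maxCurvature_eq (hab : a < b) (hb : b < a + ℓ) (h : Touches γ ℓ a b) :
    ∃ x ∈ Ioo a b, maxCurvature γ ℓ x = signedCurvature γ x := by
  have hsub : ∀ {u v}, a < u → u < v → v < b → Touches γ ℓ u v →
      ∃ x ∈ Ioo a b, maxCurvature γ ℓ x = signedCurvature γ x := by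
    intro u v hau huv hvb huv'
    obtain ⟨x, hx, heq⟩ := hγ.exists_mem_Icc_maxCurvature_eq huv (by linarith) huv'
    exact ⟨x, ⟨hau.trans_le hx.1, hx.2.trans_lt hvb⟩, heq⟩
  by_cases hall : ∀ m ∈ Ioo a b, Touches γ ℓ a m
  · obtain ⟨u, hau, hub⟩ := exists_between hab
    obtain ⟨v, huv, hvb⟩ := exists_between hub
    exact hsub hau huv hvb (hγ.touches_trans (hγ.touches_symm (hall u ⟨hau, hub⟩))
      (hall v ⟨hau.trans huv, hvb⟩))
  · push Not at hall
    obtain ⟨m, hm, ham⟩ := hall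
    rcases hγ.maxCurvature_eq_or_exists_touches_of_mem_Ioo hb h hm with
      heq | ham' | ⟨u, v, hau, huv, hvb, huv'⟩
    · exact ⟨m, hm, heq⟩
    · exact absurd ham' ham
    · exact hsub hau huv hvb huv'

theorem exists_two_maxCurvature_eq : ∃ s₁ s₂, γ s₁ ≠ γ s₂ ∧
    maxCurvature γ ℓ s₁ = signedCurvature γ s₁ ∧ maxCurvature γ ℓ s₂ = signedCurvature γ s₂ := by
  have hℓ := hγ.period_pos
  by_cases hall : ∀ t, maxCurvature γ ℓ t = signedCurvature γ t
  · exact ⟨ℓ / 2, 0, hγ.apply_ne_of_mem_Ioo ⟨by linarith, by linarith⟩, hall _, hall _⟩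
  · push Not at hall
    obtain ⟨t, ht⟩ := hall
    obtain ⟨s, ⟨hts, hst⟩, htouch⟩ := (hγ.maxCurvature_eq_or_exists_touches t).resolve_left ht
    obtain ⟨x, hx, hxK⟩ := hγ.exists_mem_Ioo_maxCurvature_eq hts hst htouch
    obtain ⟨y, hy, hyK⟩ := hγ.exists_mem_Ioo_maxCurvature_eq hst (by linarith)
      (hγ.touches_add_period.2 (hγ.touches_symm htouch))
    exact ⟨y, x, hγ.apply_ne_of_mem_Ioo ⟨hx.2.trans hy.1, by linarith [hy.2, hx.1]⟩, hyK, hxK⟩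

end MinimalChord

end IsSimpleClosedSmoothRegularCurve

namespace PlaneCurve

open Set Filter Topology

/-- The curve `γ` does not meet the open region to the left of its osculating circline at `t`. -/
def OsculatedFromLeftAt (γ : ℝ → Plane) (t : ℝ) : Prop :=
  SupportedFromLeft γ (signedCurvature γ t) t

/-- The curve `γ` does not meet the open region to the right of its osculating circline at `t`. -/
def OsculatedFromRightAt (γ : ℝ → Plane) (t : ℝ) : Prop := OsculatedFromLeftAt (reverse γ) (-t)

variable {γ : ℝ → Plane} {κ t : ℝ}

theorem supportedFromLeft_reverse_iff :
    SupportedFromLeft (reverse γ) (-κ) (-t) ↔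
      ∀ s, 0 ≤ circlineFun κ (normal γ t) (γ t) (γ s) := by
  simp only [SupportedFromLeft, circlineFun_reverse, neg_neg, neg_nonpos]
  exact ⟨fun h s => by simpa only [reverse, neg_neg] using h (-s), fun h s => h (-s)⟩

theorem osculatedFromRightAt_iff :
    OsculatedFromRightAt γ t ↔
      ∀ s, 0 ≤ circlineFun (signedCurvature γ t) (normal γ t) (γ t) (γ s) := by
  rw [OsculatedFromRightAt, OsculatedFromLeftAt, signedCurvature_reverse, neg_neg,
    supportedFromLeft_reverse_iff]

theorem osculatingCircline_reverse (ht : deriv γ t ≠ 0) :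
    osculatingCircline (reverse γ) (-t) = osculatingCircline γ t := by
  have ht' : deriv (reverse γ) (-t) ≠ 0 := by rwa [deriv_reverse, neg_neg, neg_ne_zero]
  rw [osculatingCircline_eq ht, osculatingCircline_eq ht']
  ext x
  simp only [mem_ofPred_eq, signedCurvature_reverse, circlineFun_reverse, neg_neg, neg_eq_zero]

theorem OsculatedFromLeftAt.globallySupportsAt (h : OsculatedFromLeftAt γ t)
    (ht : deriv γ t ≠ 0) :
    GloballySupportsAt (osculatingCircline γ t) (range γ) (γ t) := by
  set f := circlineFun (signedCurvature γ t) (normal γ t) (γ t) with hf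
  have hpre : IsPreconnected {x | f x < 0} := by
    simpa only [circlineFun_neg_neg, neg_pos] using
      isPreconnected_setOf_circlineFun_pos one_lt_rank_plane (-signedCurvature γ t) (-normal γ t)
        (γ t)
  obtain ⟨x, hx⟩ : ∃ x, f x < 0 := by
    obtain ⟨ε, hε⟩ := (eventually_circlineFun_add_smul_pos (neg_ne_zero.2 (normal_ne_zero ht))
      (-signedCurvature γ t) (γ t)).exists
    rw [circlineFun_neg_neg, neg_pos] at hε
    exact ⟨_, hε⟩
  rw [osculatingCircline_eq ht, ← hf]
  have hsub : {x | f x < 0} ⊆ {x | f x = 0}ᶜ := fun y hy => hy.ne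
  refine ⟨circlineFun_self _ _ _, mem_range_self t, _, ⟨x, hsub hx, rfl⟩, ?_⟩
  rintro _ ⟨s, rfl⟩
  exact (h s).lt_or_eq.imp_left fun hs => hpre.subset_connectedComponentIn hx hsub hs

theorem OsculatedFromRightAt.globallySupportsAt (h : OsculatedFromRightAt γ t)
    (ht : deriv γ t ≠ 0) :
    GloballySupportsAt (osculatingCircline γ t) (range γ) (γ t) := by
  have hrev := OsculatedFromLeftAt.globallySupportsAt h
    (by rwa [deriv_reverse, neg_neg, neg_ne_zero])
  rwa [range_reverse, osculatingCircline_reverse ht, reverse, neg_neg] at hrev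

end PlaneCurve

namespace IsSimpleClosedSmoothRegularCurve

open Set PlaneCurve

variable {γ : ℝ → Plane} {ℓ κ s t : ℝ} (hγ : IsSimpleClosedSmoothRegularCurve γ ℓ)
include hγ

section FourPoints

theorem isVertexAt_of_osculatedFromLeftAt (h : OsculatedFromLeftAt γ t) : IsVertexAt γ t :=
  isVertexAt_of_supportedFromLeft hγ.smooth hγ.regular h

theorem isVertexAt_of_osculatedFromRightAt (h : OsculatedFromRightAt γ t) : IsVertexAt γ t :=
  neg_neg t ▸ isVertexAt_of_isVertexAt_reverse (hγ.reverse.isVertexAt_of_osculatedFromLeftAt h)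

theorem osculatingCircline_subset_leftSide_union (h : OsculatedFromLeftAt γ t) :
    osculatingCircline γ t ⊆ leftSide γ ∪ range γ := by
  rw [osculatingCircline_eq (hγ.regular t)]
  intro x hx
  by_cases hxγ : x ∈ range γ
  · exact Or.inr hxγ
  · exact Or.inl (hγ.mem_leftSide_of_circlineFun_nonneg h hxγ (Eq.ge hx))

theorem osculatingCircline_subset_rightSide_union (h : OsculatedFromRightAt γ t) :
    osculatingCircline γ t ⊆ rightSide γ ∪ range γ := by
  rw [← osculatingCircline_reverse (hγ.regular t), ← range_reverse]
  exact hγ.reverse.osculatingCircline_subset_leftSide_union h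

theorem exists_two_osculatedFromLeftAt :
    ∃ s₁ s₂, γ s₁ ≠ γ s₂ ∧ OsculatedFromLeftAt γ s₁ ∧ OsculatedFromLeftAt γ s₂ := by
  obtain ⟨s₁, s₂, hne, h₁, h₂⟩ := hγ.exists_two_maxCurvature_eq
  exact ⟨s₁, s₂, hne, hγ.supportedFromLeft_iff.2 h₁.le, hγ.supportedFromLeft_iff.2 h₂.le⟩

theorem exists_two_osculatedFromRightAt :
    ∃ s₁ s₂, γ s₁ ≠ γ s₂ ∧ OsculatedFromRightAt γ s₁ ∧ OsculatedFromRightAt γ s₂ := by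
  obtain ⟨s₁, s₂, hne, h₁, h₂⟩ := hγ.reverse.exists_two_osculatedFromLeftAt
  exact ⟨-s₁, -s₂, hne, by rwa [OsculatedFromRightAt, neg_neg],
    by rwa [OsculatedFromRightAt, neg_neg]⟩

theorem periodic_osculatedFromLeftAt : Function.Periodic (OsculatedFromLeftAt γ) ℓ := fun t => by
  have hcurv : signedCurvature γ (t + ℓ) = signedCurvature γ t := by
    have hderiv {f : ℝ → Plane} (hf : Function.Periodic f ℓ) : deriv f (t + ℓ) = deriv f t := by
      rw [← deriv_comp_add_const, funext hf]
    rw [signedCurvature, signedCurvature, hderiv hγ.periodic, hderiv hγ.periodic_tangent,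
      hγ.periodic_normal]
  rw [OsculatedFromLeftAt, OsculatedFromLeftAt, SupportedFromLeft, SupportedFromLeft, hcurv,
    hγ.periodic, hγ.periodic_normal]

theorem osculatedFromLeftAt_congr (hst : γ s = γ t) :
    OsculatedFromLeftAt γ s ↔ OsculatedFromLeftAt γ t := by
  have hper : Function.Periodic (fun t => (γ t, OsculatedFromLeftAt γ t)) ℓ := fun t =>
    Prod.ext (hγ.periodic t) (hγ.periodic_osculatedFromLeftAt t)
  obtain ⟨y, hy, heq⟩ := hper.exists_mem_Ico hγ.period_pos s t
  obtain ⟨hsy, hosc⟩ := Prod.mk.inj heq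
  obtain rfl := hγ.eq_of_mem_Ico hy (hsy.symm.trans hst)
  exact iff_of_eq hosc

theorem signedCurvature_le (h : SupportedFromLeft γ κ t) : signedCurvature γ t ≤ κ :=
  (hγ.signedCurvature_le_maxCurvature t).trans (hγ.supportedFromLeft_iff.1 h)

theorem le_signedCurvature (h : ∀ s, 0 ≤ circlineFun κ (normal γ t) (γ t) (γ s)) :
    κ ≤ signedCurvature γ t := by
  have hrev := hγ.reverse.signedCurvature_le (supportedFromLeft_reverse_iff.2 h)
  rwa [signedCurvature_reverse, neg_neg, neg_le_neg_iff] at hrev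

/-- The two hypotheses say that the curve is contained in its osculating circline at `t`. -/
theorem osculatedFromLeftAt_and_osculatedFromRightAt (hl : OsculatedFromLeftAt γ t)
    (hr : OsculatedFromRightAt γ t) (s : ℝ) :
    OsculatedFromLeftAt γ s ∧ OsculatedFromRightAt γ s := by
  have hzero (r) : circlineFun (signedCurvature γ t) (normal γ t) (γ t) (γ r) = 0 :=
    le_antisymm (hl r) (osculatedFromRightAt_iff.1 hr r)
  have hzero' (r) : circlineFun (signedCurvature γ t) (normal γ s) (γ s) (γ r) = 0 := by
    rw [← hγ.normal_sub_smul_of_circlineFun_eq_zero hl (hzero s), circlineFun_sub_smul, hzero,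
      hzero, sub_zero]
  have hcurv : signedCurvature γ s = signedCurvature γ t :=
    le_antisymm (hγ.signedCurvature_le fun r => (hzero' r).le)
      (hγ.le_signedCurvature fun r => (hzero' r).ge)
  rw [← hcurv] at hzero'
  exact ⟨fun r => (hzero' r).le, osculatedFromRightAt_iff.2 fun r => (hzero' r).ge⟩

theorem exists_four_osculatedAt : ∃ s₁ s₂ s₃ s₄, [γ s₁, γ s₂, γ s₃, γ s₄].Nodup ∧
    OsculatedFromLeftAt γ s₁ ∧ OsculatedFromLeftAt γ s₂ ∧
    OsculatedFromRightAt γ s₃ ∧ OsculatedFromRightAt γ s₄ := by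
  by_cases hex : ∃ t, OsculatedFromLeftAt γ t ∧ OsculatedFromRightAt γ t
  · obtain ⟨t, hl, hr⟩ := hex
    have hall := hγ.osculatedFromLeftAt_and_osculatedFromRightAt hl hr
    have hℓ := hγ.period_pos
    refine ⟨3 * ℓ / 4, ℓ / 2, ℓ / 4, 0, ?_, (hall _).1, (hall _).1, (hall _).2, (hall _).2⟩
    simp only [List.nodup_cons, List.mem_cons, List.not_mem_nil, or_false, not_or,
      not_false_eq_true, List.nodup_nil, and_true]
    refine ⟨⟨?_, ?_, ?_⟩, ⟨?_, ?_⟩, ?_⟩ <;>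
      exact hγ.apply_ne_of_mem_Ioo ⟨by linarith, by linarith⟩
  · obtain ⟨s₁, s₂, hs, hs₁, hs₂⟩ := hγ.exists_two_osculatedFromLeftAt
    obtain ⟨t₁, t₂, ht, ht₁, ht₂⟩ := hγ.exists_two_osculatedFromRightAt
    have hne {s t} (hl : OsculatedFromLeftAt γ s) (hr : OsculatedFromRightAt γ t) : γ s ≠ γ t :=
      fun hst => hex ⟨t, (hγ.osculatedFromLeftAt_congr hst).1 hl, hr⟩
    refine ⟨s₁, s₂, t₁, t₂, ?_, hs₁, hs₂, ht₁, ht₂⟩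
    simp [hs, ht, hne hs₁ ht₁, hne hs₁ ht₂, hne hs₂ ht₁, hne hs₂ ht₂]

end FourPoints

end IsSimpleClosedSmoothRegularCurve

theorem mainTheorem2 (γ : ℝ → Plane) (ℓ : ℝ) (hγ : IsSimpleClosedSmoothRegularCurve γ ℓ) :
    (∃ s₁ s₂ s₃ s₄ : ℝ,
      [γ s₁, γ s₂, γ s₃, γ s₄].Nodup ∧
      PlaneCurve.GloballySupportsFromInsideAt
        (PlaneCurve.osculatingCircline γ s₁) (Set.range γ) (γ s₁) ∧
      PlaneCurve.GloballySupportsFromInsideAt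
        (PlaneCurve.osculatingCircline γ s₂) (Set.range γ) (γ s₂) ∧
      PlaneCurve.GloballySupportsFromOutsideAt
        (PlaneCurve.osculatingCircline γ s₃) (Set.range γ) (γ s₃) ∧
      PlaneCurve.GloballySupportsFromOutsideAt
        (PlaneCurve.osculatingCircline γ s₄) (Set.range γ) (γ s₄)) ∧
    (∃ t₁ t₂ t₃ t₄ : ℝ,
      [γ t₁, γ t₂, γ t₃, γ t₄].Nodup ∧
      PlaneCurve.IsVertexAt γ t₁ ∧ PlaneCurve.IsVertexAt γ t₂ ∧
      PlaneCurve.IsVertexAt γ t₃ ∧ PlaneCurve.IsVertexAt γ t₄) := by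
  obtain ⟨s₁, s₂, s₃, s₄, hnodup, h₁, h₂, h₃, h₄⟩ := hγ.exists_four_osculatedAt
  refine ⟨?_, s₁, s₂, s₃, s₄, hnodup, hγ.isVertexAt_of_osculatedFromLeftAt h₁,
    hγ.isVertexAt_of_osculatedFromLeftAt h₂, hγ.isVertexAt_of_osculatedFromRightAt h₃,
    hγ.isVertexAt_of_osculatedFromRightAt h₄⟩
  have hsupp₁ := h₁.globallySupportsAt (hγ.regular s₁)
  have hsupp₂ := h₂.globallySupportsAt (hγ.regular s₂)
  have hsupp₃ := h₃.globallySupportsAt (hγ.regular s₃)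
  have hsupp₄ := h₄.globallySupportsAt (hγ.regular s₄)
  have hleft {t} := hγ.osculatingCircline_subset_leftSide_union (t := t)
  have hright {t} := hγ.osculatingCircline_subset_rightSide_union (t := t)
  rcases hγ.sides_eq_inside_outside with ⟨hl, hr⟩ | ⟨hl, hr⟩
  · rw [hl] at hleft
    rw [hr] at hright
    exact ⟨s₁, s₂, s₃, s₄, hnodup, ⟨hsupp₁, hleft h₁⟩, ⟨hsupp₂, hleft h₂⟩, ⟨hsupp₃, hright h₃⟩,
      ⟨hsupp₄, hright h₄⟩⟩
  · rw [hl] at hleft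
    rw [hr] at hright
    exact ⟨s₃, s₄, s₁, s₂, (List.perm_append_comm (l₁ := [γ s₁, γ s₂])).nodup_iff.1 hnodup,
      ⟨hsupp₃, hright h₃⟩, ⟨hsupp₄, hright h₄⟩, ⟨hsupp₁, hleft h₁⟩, ⟨hsupp₂, hleft h₂⟩⟩
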